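/- Fix an integer $n\ge 2$. A Gelfand–Tsetlin tableau $T(L)$ of height $n$ is a triangular array $L=(l_{ij})_{1\le j\le i\le n}$ of complex numbers; $\delta^{ki}$ denotes the array with entry $1$ at $(k,i)$ and $0$ elsewhere. Assume that $T(L)$ is generic, i.e. $l_{ki}-l_{kj}\notin\mathbb Z$ for all $1\le i\ne j\le k\le n-1$ (no condition on the top row $k=n$). Let $\mathcal B(T(L))$ be the set of tableaux $T(L+z)$, where $z$ runs over the integral triangular arrays with zero top row, and let $V(T(L))$ be the complex vector space with basis $\mathcal B(T(L))$. For $T(R)\in\mathcal B(T(L))$ put $$\Omega^+(T(R))=\{(p,s,u): 1<p\le n,\ 1\le s\le p,\ 1\le u\le p-1,\ r_{p,s}-r_{p-1,u}\in\mathbb Z_{\ge 0}\},$$ $$\mathcal N(T(R))=\{T(Q)\in\mathcal B(T(L)):\Omega^+(T(R))\subseteq\Omega^+(T(Q))\},\qquad W(T(R))=\operatorname{span}\mathcal N(T(R)).$$ Theorem. There is a unique $\mathfrak{gl}(n)$-module structure on $V(T(L))$ for which the elementary matrices act on every $T(Q)\in\mathcal B(T(L))$ by the Gelfand–Tsetlin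 formulas $$E_{k,k+1}T(Q)=-\sum_{i=1}^{k}\frac{\prod_{j=1}^{k+1}(q_{ki}-q_{k+1,j})}{\prod_{1\le j\le k,\,j\neq i}(q_{ki}-q_{kj})}\,T(Q+\delta^{ki})\quad(1\le k\le n-1),$$ $$E_{k+1,k}T(Q)=\sum_{i=1}^{k}\frac{\prod_{j=1}^{k-1}(q_{ki}-q_{k-1,j})}{\prod_{1\le j\le k,\,j\neq i}(q_{ki}-q_{kj})}\,T(Q-\delta^{ki})\quad(1\le k\le n-1),$$ $$E_{kk}T(Q)=\Big(k-1+\sum_{i=1}^{k}q_{ki}-\sum_{i=1}^{k-1}q_{k-1,i}\Big)T(Q)\quad(1\le k\le n).$$ With this structure, for every $T(R)\in\mathcal B(T(L))$ the $\mathfrak{gl}(n)$-submodule $U\cdot T(R)$ of $V(T(L))$ generated by $T(R)$ equals $W(T(R))$. In particular, $\mathcal N(T(R))$ is a basis of $U\cdot T(R)$, and on this basis the (restricted) action of $\mathfrak{gl}(n)$ on $U\cdot T(R)$ is given by the Gelfand–Tsetlin formulas above, where the terms with tableaux outside $\mathcal N(T(R))$ are omitted (their coefficients vanish). -/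

import Mathlib

-- Associative rings (matrices, endomorphisms) carry the commutator bracket.
attribute [local instance 100] LieRing.ofAssociativeRing

namespace GelfandTsetlin

/-- Positions `(i, j)` with `1 ≤ j ≤ i ≤ n` of a triangular array of height `n`
(rows and entries are numbered from `1`, row `n` is the top row). -/
abbrev Pos (n : ℕ) : Type := {p : ℕ × ℕ // 1 ≤ p.2 ∧ p.2 ≤ p.1 ∧ p.1 ≤ n}

/-- Gelfand–Tsetlin tableaux of height `n`: triangular arrays of complex numbers. -/
abbrev Tableau (n : ℕ) : Type := Pos n → ℂ

/-- The entry `l_{ij}` of a tableau (only used for `1 ≤ j ≤ i ≤ n`; zero for other indices). -/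
noncomputable def Tableau.entry {n : ℕ} (L : Tableau n) (i j : ℕ) : ℂ :=
  if h : 1 ≤ j ∧ j ≤ i ∧ i ≤ n then L ⟨(i, j), h⟩ else 0

/-- The integral array `δ^{ki}`: one at position `(k, i)`, zero elsewhere. -/
def delta (n k i : ℕ) : Pos n → ℤ := fun p => if p.1 = (k, i) then 1 else 0

/-- `T(L + z)` for an integral array `z`. -/
noncomputable def Tableau.translate {n : ℕ} (L : Tableau n) (z : Pos n → ℤ) : Tableau n :=
  fun p => L p + (z p : ℂ)

/-- A tableau is generic if any two distinct entries of the same row `k ≤ n - 1` have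
a nonintegral difference. There is no condition on the top row. -/
def IsGeneric {n : ℕ} (L : Tableau n) : Prop :=
  ∀ k i j : ℕ, k < n → 1 ≤ i → i ≤ k → 1 ≤ j → j ≤ k → i ≠ j →
    ∀ m : ℤ, L.entry k i - L.entry k j ≠ (m : ℂ)

/-- `𝓑(T(L))`: the tableaux `T(L + z)`, `z` integral with zero top row. -/
def tableauSet {n : ℕ} (L : Tableau n) : Set (Tableau n) :=
  {R | ∃ z : Pos n → ℤ, (∀ p, p.1.1 = n → z p = 0) ∧ R = L.translate z}

/-- `V(T(L))`: the complex vector space with basis `𝓑(T(L))`. -/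
def V {n : ℕ} (L : Tableau n) : Type := tableauSet L →₀ ℂ

noncomputable instance {n : ℕ} (L : Tableau n) : AddCommGroup (V L) :=
  inferInstanceAs (AddCommGroup (tableauSet L →₀ ℂ))

noncomputable instance {n : ℕ} (L : Tableau n) : Module ℂ (V L) :=
  inferInstanceAs (Module ℂ (tableauSet L →₀ ℂ))

/-- The defining basis of `V(T(L))`, indexed by the tableaux of `𝓑(T(L))`. -/
noncomputable def tableauBasis {n : ℕ} (L : Tableau n) : Module.Basis (tableauSet L) ℂ (V L) :=
  Module.Basis.ofRepr (LinearEquiv.refl ℂ (V L))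

/-- The tableau `R ∈ 𝓑(T(L))` as a basis vector of `V(T(L))`. -/
noncomputable def basisVec {n : ℕ} {L : Tableau n} (R : tableauSet L) : V L :=
  tableauBasis L R

theorem translate_delta_mem {n : ℕ} {L : Tableau n} (R : tableauSet L) (k i : ℕ) (hk : k < n)
    (c : ℤ) : (R : Tableau n).translate (c • delta n k i) ∈ tableauSet L := by
  obtain ⟨R, z, hz, rfl⟩ := R
  refine ⟨z + c • delta n k i, fun p hp => ?_, ?_⟩
  · have h : p.1 ≠ (k, i) := fun h => by rw [h] at hp; exact absurd hp hk.ne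
    simp [hz p hp, delta, h]
  · funext p
    simp [Tableau.translate, add_assoc]

/-- `T(R + c δ^{ki})` for `T(R) ∈ 𝓑(T(L))` and a row `k ≤ n - 1`. -/
noncomputable def shift {n : ℕ} {L : Tableau n} (R : tableauSet L) (k i : ℕ) (hk : k < n)
    (c : ℤ) : tableauSet L :=
  ⟨(R : Tableau n).translate (c • delta n k i), translate_delta_mem R k i hk c⟩

/-- The coefficient of `T(L + δ^{ki})` in `E_{k,k+1} T(L)`. -/
noncomputable def raiseCoeff {n : ℕ} (L : Tableau n) (k i : ℕ) : ℂ :=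
  -((∏ j ∈ Finset.Icc 1 (k + 1), (L.entry k i - L.entry (k + 1) j)) /
    ∏ j ∈ (Finset.Icc 1 k).erase i, (L.entry k i - L.entry k j))

/-- The coefficient of `T(L - δ^{ki})` in `E_{k+1,k} T(L)`. -/
noncomputable def lowerCoeff {n : ℕ} (L : Tableau n) (k i : ℕ) : ℂ :=
  (∏ j ∈ Finset.Icc 1 (k - 1), (L.entry k i - L.entry (k - 1) j)) /
    ∏ j ∈ (Finset.Icc 1 k).erase i, (L.entry k i - L.entry k j)

/-- The eigenvalue of `E_{kk}` on `T(L)`. -/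
noncomputable def diagCoeff {n : ℕ} (L : Tableau n) (k : ℕ) : ℂ :=
  (k : ℂ) - 1 + ∑ i ∈ Finset.Icc 1 k, L.entry k i - ∑ i ∈ Finset.Icc 1 (k - 1), L.entry (k - 1) i

/-- The Lie algebra `𝔤𝔩(n)` of all complex `n × n` matrices with the commutator bracket. -/
abbrev gl (n : ℕ) : Type := Matrix (Fin n) (Fin n) ℂ

/-- The elementary matrix `E_{ij}`, with `1 ≤ i, j ≤ n` numbered from `1`. -/
def E (n i j : ℕ) : gl n :=
  Matrix.of fun a b => if (a : ℕ) + 1 = i ∧ (b : ℕ) + 1 = j then 1 else 0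

open Classical in
/-- A family indexed by a set of tableaux, extended by zero to all of `𝓑(T(L))`. -/
noncomputable def extendZero {n : ℕ} {L : Tableau n} {M : Type*} [AddCommGroup M]
    {S : Set (tableauSet L)} (t : S → M) (Q : tableauSet L) : M :=
  if h : Q ∈ S then t ⟨Q, h⟩ else 0

/-- A representation `σ` of `𝔤𝔩(n)` on `M` acts by the Gelfand–Tsetlin formulas on the vectors
`t Q`, where `Q` runs through a set `S ⊆ 𝓑(T(L))` (tableaux outside `S` are read as zero). -/
structure ActsByGTFormulas {n : ℕ} {L : Tableau n} {M : Type*} [AddCommGroup M] [Module ℂ M]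
    (S : Set (tableauSet L)) (t : S → M) (σ : gl n →ₗ⁅ℂ⁆ Module.End ℂ M) : Prop where
  raise : ∀ (k : ℕ) (_ : 1 ≤ k) (hk : k < n) (Q : S),
    σ (E n k (k + 1)) (t Q) =
      ∑ i ∈ Finset.Icc 1 k, raiseCoeff (Q : tableauSet L).1 k i • extendZero t (shift Q.1 k i hk 1)
  lower : ∀ (k : ℕ) (_ : 1 ≤ k) (hk : k < n) (Q : S),
    σ (E n (k + 1) k) (t Q) =
      ∑ i ∈ Finset.Icc 1 k,
        lowerCoeff (Q : tableauSet L).1 k i • extendZero t (shift Q.1 k i hk (-1))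
  diag : ∀ (k : ℕ) (_ : 1 ≤ k) (_ : k ≤ n) (Q : S),
    σ (E n k k) (t Q) = diagCoeff (Q : tableauSet L).1 k • t Q

/-- `ρ` is a `𝔤𝔩(n)`-module structure on `V(T(L))` given by the Gelfand–Tsetlin formulas on
all tableaux of `𝓑(T(L))`. -/
def IsGTModuleStructure {n : ℕ} (L : Tableau n) (ρ : gl n →ₗ⁅ℂ⁆ Module.End ℂ (V L)) : Prop :=
  ActsByGTFormulas (Set.univ : Set (tableauSet L)) (fun Q => basisVec Q.1) ρ

/-- `Ω⁺(T(R))`. -/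
def OmegaPlus {n : ℕ} (R : Tableau n) : Set (ℕ × ℕ × ℕ) :=
  {x | (1 < x.1 ∧ x.1 ≤ n) ∧ (1 ≤ x.2.1 ∧ x.2.1 ≤ x.1) ∧ (1 ≤ x.2.2 ∧ x.2.2 ≤ x.1 - 1) ∧
    ∃ m : ℕ, R.entry x.1 x.2.1 - R.entry (x.1 - 1) x.2.2 = (m : ℂ)}

/-- `𝓝(T(R))`: the tableaux `T(Q) ∈ 𝓑(T(L))` with `Ω⁺(T(R)) ⊆ Ω⁺(T(Q))`. -/
def N {n : ℕ} {L : Tableau n} (R : tableauSet L) : Set (tableauSet L) :=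
  {Q | OmegaPlus (R : Tableau n) ⊆ OmegaPlus (Q : Tableau n)}

/-- `W(T(R))`: the span of `𝓝(T(R))`. -/
noncomputable def W {n : ℕ} {L : Tableau n} (R : tableauSet L) : Submodule ℂ (V L) :=
  Submodule.span ℂ (basisVec '' N R)

/-- The submodule of a representation generated by a vector `v`: the smallest
subspace containing `v` and stable under the action of the Lie algebra. -/
def generatedSubmodule {n : ℕ} {M : Type*} [AddCommGroup M] [Module ℂ M]
    (ρ : gl n →ₗ⁅ℂ⁆ Module.End ℂ M) (v : M) : Submodule ℂ M :=
  sInf {P | v ∈ P ∧ ∀ (x : gl n), ∀ w ∈ P, ρ x w ∈ P}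

end GelfandTsetlin

open GelfandTsetlin

/-! Existence. The formulas define operators for the Chevalley generators, and one checks the Serre
relations for them. Genericity keeps the denominators nonzero; the top row occurs only in
numerators, so nothing is asked of it. Most relations are rational identities in at most two moving
entries. The substantial one is ⁅e_k, f_k⁆ = h_k - h_{k+1}: the off-diagonal terms cancel, and the
diagonal ones are a sum of residues, evaluated by Lagrange interpolation (`rowOp_lie_same_row`,
`sum_residues_one`). `SerreRelations.exists_lieHom` turns the relations into a representation;
uniqueness holds because the generators generate 𝔤𝔩(n).

W(T(R)) is stable: a step ±δ^{ki} can destroy a relation of Ω⁺ only where an integral difference is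
0, and there the coefficient contains that difference as a factor (`omegaPlus_subset_raise`,
`omegaPlus_subset_lower`).

W(T(R)) is generated by T(R). First, the sums of squares of the rows act on every submodule, being
polynomials in the generators (`rowSumSq_mem`). They separate the tableaux occurring in one
generator applied to one tableau, so each term with nonzero coefficient lies in the submodule by
itself. Second, if Ω⁺(X) ⊆ Ω⁺(Q), there is a path from X to Q of single steps with nonzero
coefficients, each of which preserves the inclusion. The entry to move is an extremal one for the
weight Re(x_{ki}) + k/2 (`exists_raise_step`, `exists_lower_step`). -/

namespace GelfandTsetlin

/-! ### Consequences of the Serre relations in an abstract Lie ring. -/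

section Serre

variable {A : Type*} [LieRing A]

/-- The Chevalley–Serre relations for `𝔤𝔩(n)` between raising elements `e k = E_{k,k+1}`, lowering
elements `f k = E_{k+1,k}` and diagonal elements `h k = E_{k,k}`, numbered from `0`. -/
structure SerreRelations (n : ℕ) (e f h : ℕ → A) : Prop where
  hh : ∀ i j, i < n → j < n → ⁅h i, h j⁆ = 0
  he : ∀ i k, i < n → k + 1 < n →
    ⁅h i, e k⁆ = (if i = k then e k else 0) - (if i = k + 1 then e k else 0)
  hf : ∀ i k, i < n → k + 1 < n →
    ⁅h i, f k⁆ = (if i = k + 1 then f k else 0) - (if i = k then f k else 0)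
  ef : ∀ k l, k + 1 < n → l + 1 < n → ⁅e k, f l⁆ = if k = l then h k - h (k + 1) else 0
  ee : ∀ k l, k + 1 < l → l + 1 < n → ⁅e k, e l⁆ = 0
  ff : ∀ k l, k + 1 < l → l + 1 < n → ⁅f k, f l⁆ = 0
  eee : ∀ k, k + 2 < n → ⁅e k, ⁅e k, e (k + 1)⁆⁆ = 0
  eee' : ∀ k, k + 2 < n → ⁅e (k + 1), ⁅e (k + 1), e k⁆⁆ = 0
  fff : ∀ k, k + 2 < n → ⁅f k, ⁅f k, f (k + 1)⁆⁆ = 0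
  fff' : ∀ k, k + 2 < n → ⁅f (k + 1), ⁅f (k + 1), f k⁆⁆ = 0

/-- The root element `E_{a,a+d+1}`, as an iterated bracket of simple root elements. -/
def rootElement (e : ℕ → A) (a : ℕ) : ℕ → A
  | 0 => e a
  | d + 1 => ⁅rootElement e a d, e (a + d + 1)⁆

/-- The element `E_{a,b}` built from Chevalley generators. -/
def unitElement (e f h : ℕ → A) (a b : ℕ) : A :=
  if a = b then h a else if a < b then rootElement e a (b - a - 1)
    else -rootElement (fun k => -f k) b (a - b - 1)

theorem ite_zero_lie (p : Prop) [Decidable p] (x y : A) :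
    ⁅if p then x else 0, y⁆ = if p then ⁅x, y⁆ else 0 := by split_ifs <;> simp

theorem lie_ite_zero (p : Prop) [Decidable p] (x y : A) :
    ⁅x, if p then y else 0⁆ = if p then ⁅x, y⁆ else 0 := by split_ifs <;> simp

/-- Jacobi turns ⁅⁅u, x⁆, y⁆ into ⁅u, ⁅x, y⁆⁆, and `y` commutes with both `u` and ⁅x, y⁆. -/
theorem lie_lie_lie_eq_zero {u x y : A} (h1 : ⁅u, y⁆ = 0) (h2 : ⁅y, ⁅y, x⁆⁆ = 0) :
    ⁅⁅⁅u, x⁆, y⁆, y⁆ = 0 := by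
  have h3 : ⁅⁅x, y⁆, y⁆ = 0 := by
    rw [← lie_skew, ← lie_skew x y, lie_neg, h2]; simp
  have h4 : ⁅⁅u, x⁆, y⁆ = ⁅u, ⁅x, y⁆⁆ := by rw [lie_lie, h1]; simp
  rw [h4, lie_lie, h3, h1]; simp

/-- Expanding by Jacobi in two ways gives ⁅⁅u, x⁆, ⁅x, y⁆⁆ with opposite signs. Division by 2 is why
complex scalars enter. -/
theorem lie_lie_lie_middle_eq_zero [LieAlgebra ℂ A] {u x y : A} (h1 : ⁅u, y⁆ = 0)
    (h2 : ⁅⁅u, x⁆, x⁆ = 0) (h3 : ⁅x, ⁅x, y⁆⁆ = 0) : ⁅⁅⁅u, x⁆, y⁆, x⁆ = 0 := by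
  have h4 : ⁅⁅u, x⁆, y⁆ = ⁅u, ⁅x, y⁆⁆ := by rw [lie_lie, h1]; simp
  have h5 : ⁅⁅⁅u, x⁆, y⁆, x⁆ = -⁅⁅u, x⁆, ⁅x, y⁆⁆ := by
    rw [lie_lie, h2, ← lie_skew x y, lie_neg]; simp
  have h6 : ⁅⁅⁅u, x⁆, y⁆, x⁆ = ⁅⁅u, x⁆, ⁅x, y⁆⁆ := by
    have h7 : ⁅⁅x, y⁆, x⁆ = 0 := by rw [← lie_skew, h3, neg_zero]
    rw [h4, lie_lie, h7, ← lie_skew ⁅x, y⁆]; simp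
  have h8 : (2 : ℂ) • ⁅⁅⁅u, x⁆, y⁆, x⁆ = 0 := by
    rw [two_smul]; nth_rewrite 1 [h5]; rw [h6]; simp
  simpa using h8

namespace SerreRelations

variable {n : ℕ} {e f h : ℕ → A}

/-- The Chevalley involution: every statement on raising elements yields its mirror image for
lowering ones. -/
theorem dual (S : SerreRelations n e f h) :
    SerreRelations n (fun k => -f k) (fun k => -e k) (fun k => -h k) where
  hh i j hi hj := by simp [S.hh i j hi hj]
  he i k hi hk := by
    rw [lie_neg, neg_lie, neg_neg, S.hf i k hi hk]; split_ifs <;> simp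
  hf i k hi hk := by
    rw [lie_neg, neg_lie, neg_neg, S.he i k hi hk]; split_ifs <;> simp
  ef k l hk hl := by
    rw [lie_neg, neg_lie, neg_neg, ← lie_skew, S.ef l k hl hk]
    by_cases hkl : k = l
    · subst hkl; simp; abel
    · simp [hkl, Ne.symm hkl]
  ee k l hk hl := by simp [S.ff k l hk hl]
  ff k l hk hl := by simp [S.ee k l hk hl]
  eee k hk := by simp [S.fff k hk]
  eee' k hk := by simp [S.fff' k hk]
  fff k hk := by simp [S.eee k hk]
  fff' k hk := by simp [S.eee' k hk]

theorem ee_swap (S : SerreRelations n e f h) (k l : ℕ) (hkl : k + 1 < l) (hl : l + 1 < n) :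
    ⁅e l, e k⁆ = 0 := by
  rw [← lie_skew, S.ee k l hkl hl, neg_zero]

theorem root_lie_far (S : SerreRelations n e f h) (a d k : ℕ) (hk : a + d + 1 < k)
    (hn : k + 1 < n) : ⁅rootElement e a d, e k⁆ = 0 := by
  induction d with
  | zero => exact S.ee a k hk hn
  | succ d ih =>
    rw [rootElement, lie_lie, ih (by omega), S.ee _ k (by omega) hn]; simp

theorem root_lie_below (S : SerreRelations n e f h) (a d k : ℕ) (hk : k + 1 < a)
    (hn : a + d + 1 < n) : ⁅rootElement e a d, e k⁆ = 0 := by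
  induction d with
  | zero => rw [← lie_skew]; simp [rootElement, S.ee k a hk hn]
  | succ d ih =>
    rw [rootElement, lie_lie, ih (by omega), S.ee_swap k _ (by omega) (by omega)]; simp

theorem lie_root_left (S : SerreRelations n e f h) (a d : ℕ) (hn : a + d + 2 < n) :
    ⁅e a, rootElement e (a + 1) d⁆ = rootElement e a (d + 1) := by
  induction d with
  | zero => rfl
  | succ d ih =>
    have h0 := S.ee a (a + 1 + d + 1) (by omega) (by omega)
    rw [rootElement, leibniz_lie, ih (by omega), h0, lie_zero, add_zero,
      show a + 1 + d + 1 = a + (d + 1) + 1 by ring]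
    rfl

theorem root_lie_top (S : SerreRelations n e f h) (a d : ℕ) (hn : a + d + 1 < n) :
    ⁅rootElement e a d, e (a + d)⁆ = 0 := by
  rcases d with _ | _ | d
  · simp [rootElement]
  · have := S.eee' a (by omega)
    simp only [rootElement]
    rw [← lie_skew, ← lie_skew (e a), lie_neg, add_zero, zero_add, this, neg_zero, neg_zero]
  · exact lie_lie_lie_eq_zero (S.root_lie_far a d _ (by omega) (by omega))
      (S.eee' (a + d + 1) (by omega))

/-- Adding a simple root of the segment to its root gives no root. A simple root before the last two
commutes with the last one and is handled by induction; the last two need the cubic Serre relations.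
-/
theorem root_lie_inner [LieAlgebra ℂ A] (S : SerreRelations n e f h) (a d k : ℕ)
    (hak : a ≤ k) (hk : k ≤ a + d) (hn : a + d + 1 < n) : ⁅rootElement e a d, e k⁆ = 0 := by
  induction d with
  | zero =>
    obtain rfl : k = a := by omega
    exact S.root_lie_top k 0 hn
  | succ d ih =>
    rcases Nat.lt_trichotomy k (a + d) with hlt | rfl | hgt
    · rw [rootElement, lie_lie, ih (by omega) (by omega), S.ee_swap k _ (by omega) (by omega)]
      simp
    · rcases d with _ | d
      · have := S.eee a (by omega)
        simp only [rootElement]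
        rw [← lie_skew, add_zero, this, neg_zero]
      · exact lie_lie_lie_middle_eq_zero (S.root_lie_far a d _ (by omega) (by omega))
          (S.root_lie_top a (d + 1) (by omega)) (S.eee (a + d + 1) (by omega))
    · obtain rfl : k = a + (d + 1) := by omega
      exact S.root_lie_top a (d + 1) hn

theorem h_lie_root (S : SerreRelations n e f h) (i a d : ℕ) (hi : i < n) (hn : a + d + 1 < n) :
    ⁅h i, rootElement e a d⁆ = (if i = a then rootElement e a d else 0) -
      (if i = a + d + 1 then rootElement e a d else 0) := by
  induction d with
  | zero => exact S.he i a hi hn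
  | succ d ih =>
    rw [rootElement, leibniz_lie, ih (by omega), S.he _ _ hi (by omega), sub_lie, lie_sub]
    simp only [ite_zero_lie, lie_ite_zero]
    split_ifs <;> first | omega | (simp; done) | (simp; rw [← lie_skew, neg_add_cancel])

theorem f_lie_simple (S : SerreRelations n e f h) (k a : ℕ) (hk : k + 1 < n) (ha : a + 1 < n) :
    ⁅f k, e a⁆ = if k = a then h (a + 1) - h a else 0 := by
  rw [← lie_skew, S.ef a k ha hk]
  by_cases hka : k = a
  · subst hka; simp
  · simp [hka, Ne.symm hka]

/-- Subtracting a simple root from a segment leaves a root only when it is taken from one of the two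
ends. -/
theorem f_lie_root (S : SerreRelations n e f h) (k a d : ℕ) (hk : k + 1 < n)
    (hn : a + d + 2 < n) :
    ⁅f k, rootElement e a (d + 1)⁆ = (if k = a then rootElement e (a + 1) d else 0) -
      (if k = a + d + 1 then rootElement e a d else 0) := by
  induction d with
  | zero =>
    simp only [rootElement, add_zero]
    rw [leibniz_lie, S.f_lie_simple k a hk (by omega), S.f_lie_simple k (a + 1) hk (by omega)]
    simp only [ite_zero_lie, lie_ite_zero, sub_lie, lie_sub]
    rw [← lie_skew (e a), ← lie_skew (e a), S.he _ _ (by omega) (by omega),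
      S.he _ _ (by omega) (by omega), S.he _ _ (by omega) (by omega), S.he _ _ (by omega) (by omega)]
    split_ifs <;> first | omega | simp
  | succ d ih =>
    rw [rootElement, leibniz_lie, ih (by omega), S.f_lie_simple k _ hk (by omega)]
    simp only [ite_zero_lie, lie_ite_zero, sub_lie, lie_sub]
    rw [← lie_skew _ (h _), ← lie_skew _ (h _), S.h_lie_root _ _ _ (by omega) (by omega),
      S.h_lie_root _ _ _ (by omega) (by omega)]
    have h1 : ⁅rootElement e a d, e (a + (d + 1) + 1)⁆ = 0 :=
      S.root_lie_far _ _ _ (by omega) (by omega)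
    have h2 : ⁅rootElement e (a + 1) d, e (a + (d + 1) + 1)⁆ = rootElement e (a + 1) (d + 1) := by
      rw [show a + (d + 1) + 1 = a + 1 + d + 1 by ring]; rfl
    rw [h1, h2]
    have h3 : ⁅rootElement e a d, e (a + d + 1)⁆ = rootElement e a (d + 1) := rfl
    split_ifs <;> first | omega | simp

end SerreRelations

theorem unitElement_self (e f h : ℕ → A) (a : ℕ) : unitElement e f h a a = h a := by
  simp [unitElement]

theorem unitElement_up (e f h : ℕ → A) (a d : ℕ) :
    unitElement e f h a (a + d + 1) = rootElement e a d := by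
  rw [unitElement, if_neg (by omega), if_pos (by omega), show a + d + 1 - a - 1 = d by omega]

theorem unitElement_down (e f h : ℕ → A) (a d : ℕ) :
    unitElement e f h (a + d + 1) a = -rootElement (fun k => -f k) a d := by
  rw [unitElement, if_neg (by omega), if_neg (by omega), show a + d + 1 - a - 1 = d by omega]

/-- The abstract form of X ↦ -Xᵀ; it accounts for the signs in `unitElement`. -/
theorem unitElement_dual (e f h : ℕ → A) (a b : ℕ) :
    unitElement (fun k => -f k) (fun k => -e k) (fun k => -h k) a b = -unitElement e f h b a := by
  rcases Nat.lt_trichotomy a b with hab | rfl | hab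
  · obtain ⟨d, rfl⟩ : ∃ d, b = a + d + 1 := ⟨b - a - 1, by omega⟩
    rw [unitElement_up, unitElement_down, neg_neg]
  · rw [unitElement_self, unitElement_self]
  · obtain ⟨d, rfl⟩ : ∃ d, a = b + d + 1 := ⟨a - b - 1, by omega⟩
    rw [unitElement_up, unitElement_down]
    simp

namespace SerreRelations

variable {n : ℕ} {e f h : ℕ → A}

theorem h_lie_unit (S : SerreRelations n e f h) (i a b : ℕ) (hi : i < n) (ha : a < n)
    (hb : b < n) : ⁅h i, unitElement e f h a b⁆ =
      (if a = i then unitElement e f h i b else 0) - (if b = i then unitElement e f h a i else 0) := by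
  rcases Nat.lt_trichotomy a b with hab | rfl | hab
  · obtain ⟨d, rfl⟩ : ∃ d, b = a + d + 1 := ⟨b - a - 1, by omega⟩
    rw [unitElement_up, S.h_lie_root i a d hi hb]
    congr 1
    · split_ifs with h1 h2 h2 <;> first | omega | (subst h1; simp [unitElement_up]) | rfl
    · split_ifs with h1 h2 h2 <;> first | omega | (subst h1; simp [unitElement_up]) | rfl
  · rw [unitElement_self, S.hh i a hi ha]
    split_ifs <;> simp_all
  · obtain ⟨d, rfl⟩ : ∃ d, a = b + d + 1 := ⟨a - b - 1, by omega⟩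
    have := S.dual.h_lie_root i b d hi ha
    rw [unitElement_down, lie_neg, ← neg_lie, this]
    by_cases h1 : b = i
    · subst h1
      rw [if_pos rfl, if_neg (by omega), if_neg (by omega), if_pos rfl, unitElement_down]
      simp
    · by_cases h2 : b + d + 1 = i
      · subst h2
        rw [if_neg (by omega), if_pos rfl, if_pos rfl, if_neg h1, unitElement_down]
        simp
      · rw [if_neg (Ne.symm h1), if_neg (Ne.symm h2), if_neg h2, if_neg h1]

theorem e_lie_unit [LieAlgebra ℂ A] (S : SerreRelations n e f h) (k a b : ℕ)
    (hk : k + 1 < n) (ha : a < n) (hb : b < n) : ⁅e k, unitElement e f h a b⁆ =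
      (if a = k + 1 then unitElement e f h k b else 0) -
        (if b = k then unitElement e f h a (k + 1) else 0) := by
  rcases Nat.lt_trichotomy a b with hab | rfl | hab
  · obtain ⟨d, rfl⟩ : ∃ d, b = a + d + 1 := ⟨b - a - 1, by omega⟩
    rw [unitElement_up]
    by_cases h1 : a = k + 1
    · subst h1
      rw [S.lie_root_left k d (by omega), if_pos rfl, if_neg (by omega), sub_zero,
        show k + 1 + d + 1 = k + (d + 1) + 1 by ring, unitElement_up]
    by_cases h2 : a + d + 1 = k
    · subst h2
      rw [if_neg h1, if_pos rfl, show a + d + 1 + 1 = a + (d + 1) + 1 by ring, unitElement_up,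
        ← lie_skew, zero_sub]
      rfl
    rw [if_neg h1, if_neg h2, ← lie_skew]
    rcases Nat.lt_or_ge k a with h3 | h3
    · rw [S.root_lie_below a d k (by omega) hb]; simp
    rcases Nat.lt_or_ge k (a + d + 1) with h4 | h4
    · rw [S.root_lie_inner a d k h3 (by omega) hb]; simp
    · rw [S.root_lie_far a d k (by omega) (by omega)]; simp
  · rw [unitElement_self, ← lie_skew, S.he a k ha hk]
    by_cases h1 : a = k
    · subst h1
      simpa [rootElement] using (unitElement_up e f h a 0).symm
    · by_cases h2 : a = k + 1
      · subst h2
        simpa [rootElement] using (unitElement_up e f h k 0).symm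
      · simp [h1, h2]
  · obtain ⟨d, rfl⟩ : ∃ d, a = b + d + 1 := ⟨a - b - 1, by omega⟩
    rw [unitElement_down, lie_neg, ← neg_lie]
    rcases d with _ | d
    · have := S.dual.f_lie_simple k b hk ha
      simp only [rootElement, add_zero] at this ⊢
      rw [this]
      by_cases h1 : k = b
      · subst h1; simp [unitElement_self]; abel
      · simp [h1, Ne.symm h1]
    · have := S.dual.f_lie_root k b d hk ha
      rw [this]
      by_cases h1 : k = b
      · subst h1
        rw [if_pos rfl, if_neg (by omega), if_neg (by omega), if_pos rfl,
          show k + (d + 1) + 1 = k + 1 + d + 1 by ring, unitElement_down]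
        simp
      · by_cases h2 : k = b + d + 1
        · subst h2
          rw [if_neg (by omega), if_pos rfl, if_pos (by omega), if_neg (by omega),
            unitElement_down]
          simp
        · rw [if_neg h1, if_neg h2, if_neg (by omega), if_neg (by omega)]

theorem f_lie_unit [LieAlgebra ℂ A] (S : SerreRelations n e f h) (k a b : ℕ)
    (hk : k + 1 < n) (ha : a < n) (hb : b < n) : ⁅f k, unitElement e f h a b⁆ =
      (if a = k then unitElement e f h (k + 1) b else 0) -
        (if b = k + 1 then unitElement e f h a k else 0) := by
  have := S.dual.e_lie_unit k b a hk hb ha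
  simp only [unitElement_dual, lie_neg, neg_lie, neg_neg] at this
  rw [this]
  split_ifs <;> simp [add_comm, sub_eq_add_neg]

end SerreRelations

end Serre

/-! ### Matrix units and homomorphisms out of 𝔤𝔩(n). -/

theorem E_eq_single {n : ℕ} (a b : Fin n) : E n (a + 1) (b + 1) = Matrix.single a b 1 := by
  ext i j
  simp [E, Matrix.single_apply, Fin.ext_iff, eq_comm]

theorem lie_single {n : ℕ} (a b c d : Fin n) :
    ⁅(Matrix.single a b 1 : gl n), (Matrix.single c d 1 : gl n)⁆ =
      (if c = b then Matrix.single a d 1 else 0) - (if d = a then Matrix.single c b 1 else 0) := by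
  rw [Ring.lie_def]
  congr 1
  · split_ifs with h1
    · subst h1; simp
    · rw [Matrix.single_mul_single_of_ne _ _ _ _ (Ne.symm h1)]
  · split_ifs with h1
    · subst h1; simp
    · rw [Matrix.single_mul_single_of_ne _ _ _ _ h1]

/-- Matrix units are reached by induction on the distance from the diagonal. This replaces a
presentation of 𝔤𝔩(n): it gives multiplicativity, uniqueness and stability, each time by exhibiting
a Lie subalgebra containing the generators. -/
theorem lieSubalgebra_eq_top {n : ℕ} (K : LieSubalgebra ℂ (gl n))
    (hup : ∀ k, 1 ≤ k → k < n → E n k (k + 1) ∈ K)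
    (hdown : ∀ k, 1 ≤ k → k < n → E n (k + 1) k ∈ K)
    (hdiag : ∀ k, 1 ≤ k → k ≤ n → E n k k ∈ K) : K = ⊤ := by
  have up : ∀ d a : ℕ, ∀ (h : a + d < n),
      (Matrix.single (⟨a, by omega⟩ : Fin n) ⟨a + d, h⟩ 1 : gl n) ∈ K ∧
      (Matrix.single (⟨a + d, h⟩ : Fin n) ⟨a, by omega⟩ 1 : gl n) ∈ K := by
    intro d
    induction d with
    | zero =>
      intro a h
      have := hdiag (a + 1) (by omega) (by omega)
      rw [E_eq_single ⟨a, h⟩ ⟨a, h⟩] at this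
      exact ⟨this, this⟩
    | succ d ih =>
      intro a h
      have h1 := hup (a + d + 1) (by omega) (by omega)
      rw [E_eq_single ⟨a + d, by omega⟩ ⟨a + d + 1, h⟩] at h1
      have h2 := hdown (a + d + 1) (by omega) (by omega)
      rw [E_eq_single ⟨a + d + 1, h⟩ ⟨a + d, by omega⟩] at h2
      obtain ⟨h3, h4⟩ := ih a (by omega)
      have h5 := K.lie_mem h3 h1
      have h6 := K.lie_mem h2 h4
      rw [lie_single, if_pos rfl, if_neg (by simp [Fin.ext_iff]; omega), sub_zero] at h5 h6
      exact ⟨h5, h6⟩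
  have all : ∀ a b : Fin n, (Matrix.single a b 1 : gl n) ∈ K := by
    rintro ⟨a, ha⟩ ⟨b, hb⟩
    rcases le_total a b with hab | hab
    · obtain ⟨d, rfl⟩ := Nat.exists_eq_add_of_le hab
      exact (up d a hb).1
    · obtain ⟨d, rfl⟩ := Nat.exists_eq_add_of_le hab
      exact (up d b ha).2
  refine eq_top_iff.2 fun M _ => ?_
  rw [Matrix.matrix_eq_sum_single M]
  refine sum_mem fun a _ => sum_mem fun b _ => ?_
  have := K.smul_mem (M a b) (all a b)
  rwa [Matrix.smul_single, smul_eq_mul, mul_one] at this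

/-- The representation of `𝔤𝔩(n)` afforded by elements satisfying the Serre relations. -/
theorem SerreRelations.exists_lieHom {A : Type*} [LieRing A] [LieAlgebra ℂ A] {n : ℕ}
    {e f h : ℕ → A} (S : SerreRelations n e f h) :
    ∃ φ : gl n →ₗ⁅ℂ⁆ A, (∀ k, k + 1 < n → φ (E n (k + 1) (k + 2)) = e k) ∧
      (∀ k, k + 1 < n → φ (E n (k + 2) (k + 1)) = f k) ∧
      (∀ k, k < n → φ (E n (k + 1) (k + 1)) = h k) := by
  let F := unitElement e f h
  let φ : gl n →ₗ[ℂ] A :=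
    { toFun := fun M => ∑ a, ∑ b, M a b • F a b
      map_add' := fun M M' => by simp [add_smul, Finset.sum_add_distrib]
      map_smul' := fun c M => by simp [mul_smul, Finset.smul_sum] }
  have hφ : ∀ a b : Fin n, φ (Matrix.single a b 1) = F a b := by
    intro a b
    change ∑ a', ∑ b', (Matrix.single a b (1 : ℂ)) a' b' • F a' b' = F a b
    rw [Finset.sum_eq_single a, Finset.sum_eq_single b]
    · simp
    · intro b' _ hb'; simp [Ne.symm hb']
    · simp
    · intro a' _ ha'; simp [Ne.symm ha']
    · simp
  have he : ∀ k, k + 1 < n → φ (E n (k + 1) (k + 2)) = e k := by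
    intro k hk
    rw [E_eq_single ⟨k, by omega⟩ ⟨k + 1, hk⟩, hφ]
    exact unitElement_up e f h k 0
  have hf : ∀ k, k + 1 < n → φ (E n (k + 2) (k + 1)) = f k := by
    intro k hk
    rw [E_eq_single ⟨k + 1, hk⟩ ⟨k, by omega⟩, hφ]
    simpa [rootElement] using unitElement_down e f h k 0
  have hh : ∀ k, k < n → φ (E n (k + 1) (k + 1)) = h k := by
    intro k hk
    rw [E_eq_single ⟨k, by omega⟩ ⟨k, hk⟩, hφ]
    exact unitElement_self e f h k
  -- The elements with which `φ` is compatible against everything are closed under brackets by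
  -- Jacobi, so only brackets of generators with matrix units need checking.
  let K : LieSubalgebra ℂ (gl n) :=
    { carrier := {x | ∀ y, φ ⁅x, y⁆ = ⁅φ x, φ y⁆}
      add_mem' := fun {x x'} hx hx' y => by rw [add_lie, map_add, hx, hx', map_add, add_lie]
      zero_mem' := fun y => by simp
      smul_mem' := fun c x hx y => by rw [smul_lie, map_smul, hx, map_smul, smul_lie]
      lie_mem' := fun {x x'} hx hx' y => by
        rw [lie_lie, map_sub, hx, hx', hx', hx, hx, lie_lie] }
  have hK : ∀ x, (∀ a b : Fin n, φ ⁅x, (Matrix.single a b 1 : gl n)⁆ = ⁅φ x, F a b⁆) → x ∈ K := by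
    intro x hx y
    rw [Matrix.matrix_eq_sum_single y]
    simp only [lie_sum, map_sum]
    refine Finset.sum_congr rfl fun a _ => Finset.sum_congr rfl fun b _ => ?_
    have : (Matrix.single a b (y a b) : gl n) = y a b • Matrix.single a b 1 := by
      rw [Matrix.smul_single, smul_eq_mul, mul_one]
    rw [this, lie_smul, map_smul, hx, map_smul, lie_smul, hφ]
  have hsingle : ∀ a b c d : Fin n, φ ⁅(Matrix.single a b 1 : gl n), (Matrix.single c d 1 : gl n)⁆ =
      (if (c : ℕ) = b then F a d else 0) - (if (d : ℕ) = a then F c b else 0) := by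
    intro a b c d
    rw [lie_single, map_sub]
    simp only [← Fin.ext_iff]
    split_ifs <;> simp [hφ]
  have htop : K = ⊤ := by
    refine lieSubalgebra_eq_top K ?_ ?_ ?_
    · intro k h1 h2
      obtain ⟨k, rfl⟩ := Nat.exists_eq_add_of_le' h1
      refine hK _ fun a b => ?_
      rw [he k h2, S.e_lie_unit k a b h2 a.2 b.2, E_eq_single ⟨k, by omega⟩ ⟨k + 1, h2⟩, hsingle]
    · intro k h1 h2
      obtain ⟨k, rfl⟩ := Nat.exists_eq_add_of_le' h1
      refine hK _ fun a b => ?_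
      rw [hf k h2, S.f_lie_unit k a b h2 a.2 b.2, E_eq_single ⟨k + 1, h2⟩ ⟨k, by omega⟩, hsingle]
    · intro k h1 h2
      obtain ⟨k, rfl⟩ := Nat.exists_eq_add_of_le' h1
      refine hK _ fun a b => ?_
      rw [hh k h2, S.h_lie_unit k a b h2 a.2 b.2, E_eq_single ⟨k, h2⟩ ⟨k, h2⟩, hsingle]
  refine ⟨{ φ with map_lie' := fun {x y} => ?_ }, he, hf, hh⟩
  have : x ∈ K := htop ▸ LieSubalgebra.mem_top x
  exact this y

/-! ### Residue sums by Lagrange interpolation. -/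

section Interpolation

open Polynomial

variable {ι κ : Type*}

theorem coeff_prod_X_sub_C (s : Finset ι) (a : ι → ℂ) :
    (∏ i ∈ s, (X - C (a i))).coeff s.card = 1 ∧
    (∀ j, j + 1 = s.card → (∏ i ∈ s, (X - C (a i))).coeff j = -∑ i ∈ s, a i) ∧
    (∀ j, j + 2 = s.card →
      2 * (∏ i ∈ s, (X - C (a i))).coeff j = (∑ i ∈ s, a i) ^ 2 - ∑ i ∈ s, a i ^ 2) := by
  classical
  induction s using Finset.induction_on with
  | empty => simp
  | insert b s hb ih =>
    obtain ⟨h0, h1, h2⟩ := ih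
    have hdeg : (∏ i ∈ s, (X - C (a i))).coeff (s.card + 1) = 0 :=
      coeff_eq_zero_of_natDegree_lt (by rw [natDegree_finsetProd_X_sub_C_eq_card]; omega)
    simp only [Finset.prod_insert hb, Finset.sum_insert hb, Finset.card_insert_of_notMem hb,
      sub_mul]
    refine ⟨?_, ?_, ?_⟩
    · rw [coeff_sub, coeff_X_mul, coeff_C_mul, h0, hdeg]; simp
    · rintro j hj
      obtain rfl : j = s.card := by omega
      rw [coeff_sub, coeff_C_mul, h0]
      rcases hs : s.card with _ | c
      · rw [coeff_X_mul_zero]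
        simp [Finset.card_eq_zero.1 hs]
      · rw [coeff_X_mul, h1 c hs.symm]; ring
    · intro j hj
      rw [coeff_sub, coeff_C_mul, h1 j (by omega)]
      rcases j with _ | j
      · obtain ⟨c, rfl⟩ := Finset.card_eq_one.1 (show s.card = 1 by omega)
        rw [coeff_X_mul_zero]
        simp; ring
      · rw [coeff_X_mul, mul_sub, h2 j (by omega)]; ring

variable [DecidableEq ι]

/-- The sum is the leading Lagrange coefficient of the polynomial of degree below `s.card` that
agrees with `∏ (X - w j)` at the nodes. Subtracting the nodal polynomial gives it. -/
theorem sum_eval_div_prod_sub (s : Finset ι) (t : Finset κ) (v : ι → ℂ) (w : κ → ℂ)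
    (hv : Set.InjOn v s) (hst : t.card = s.card) (hs : s.Nonempty) :
    ∑ i ∈ s, (∏ j ∈ t, (v i - w j)) / ∏ j ∈ s.erase i, (v i - v j) =
      ∑ i ∈ s, v i - ∑ j ∈ t, w j := by
  set P : ℂ[X] := ∏ j ∈ t, (X - C (w j)) with hP
  set N : ℂ[X] := ∏ i ∈ s, (X - C (v i)) with hN
  have hpos : 0 < s.card := hs.card_pos
  obtain ⟨hN0, hN1, -⟩ := coeff_prod_X_sub_C s v
  obtain ⟨hP0, hP1, -⟩ := coeff_prod_X_sub_C t w
  have hPd : P.degree = s.card := by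
    rw [← hst, hP, degree_prod_of_monic _ _ fun i _ => monic_X_sub_C _]; simp
  have hNd : N.degree = s.card := by
    rw [hN, degree_prod_of_monic _ _ fun i _ => monic_X_sub_C _]; simp
  have hPm : P.Monic := monic_prod_of_monic _ _ fun i _ => monic_X_sub_C _
  have hNm : N.Monic := monic_prod_of_monic _ _ fun i _ => monic_X_sub_C _
  have hd : (P - N).degree < s.card := by
    rw [← hPd]
    exact degree_sub_lt_left (hPd.trans hNd.symm) hPm.ne_zero (hPm.trans hNm.symm)
  have hN1' := hN1 (s.card - 1) (by omega)
  have hP1' := hP1 (s.card - 1) (by omega)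
  rw [← hN] at hN1'
  rw [← hP] at hP1'
  have h3 : ∀ i ∈ s, (P - N).eval (v i) = ∏ j ∈ t, (v i - w j) := by
    intro i hi
    simp [hP, hN, eval_prod, Finset.prod_eq_zero hi]
  have := Lagrange.coeff_eq_sum hv hd
  rw [Finset.sum_congr rfl fun i hi => by rw [h3 i hi], coeff_sub, hN1', hP1'] at this
  rw [← this]
  ring

theorem sum_mul_eval_div_prod_sub (s : Finset ι) (t : Finset κ) (v : ι → ℂ) (w : κ → ℂ)
    (hv : Set.InjOn v s) (hst : t.card = s.card) (hs : 2 ≤ s.card) :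
    ∑ i ∈ s, v i * (∏ j ∈ t, (v i - w j)) / ∏ j ∈ s.erase i, (v i - v j) =
      ((∑ i ∈ s, v i - ∑ j ∈ t, w j) ^ 2 + (∑ i ∈ s, v i ^ 2 - ∑ j ∈ t, w j ^ 2)) / 2 := by
  set P : ℂ[X] := ∏ j ∈ t, (X - C (w j)) with hP
  set N : ℂ[X] := ∏ i ∈ s, (X - C (v i)) with hN
  obtain ⟨hN0, hN1, hN2⟩ := coeff_prod_X_sub_C s v
  obtain ⟨hP0, hP1, hP2⟩ := coeff_prod_X_sub_C t w
  obtain ⟨m, hm⟩ : ∃ m, s.card = m + 2 := ⟨s.card - 2, by omega⟩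
  have hPd : P.natDegree = m + 2 := by
    rw [hP, natDegree_finsetProd_X_sub_C_eq_card]; omega
  have hNd : N.natDegree = m + 2 := by
    rw [hN, natDegree_finsetProd_X_sub_C_eq_card]; omega
  set c : ℂ := ∑ i ∈ s, v i - ∑ j ∈ t, w j with hc
  -- `c` is the coefficient of degree `s.card` in `X * (P - N)`; subtracting `c N` lowers the degree
  -- without changing the values at the nodes.
  set R : ℂ[X] := X * (P - N) - C c * N with hR
  have hN0' : N.coeff (m + 2) = 1 := by rw [← hm]; exact hN0
  have hP0' : P.coeff (m + 2) = 1 := by rw [← hm, ← hst]; exact hP0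
  have hN1' := hN1 (m + 1) (by omega)
  have hP1' := hP1 (m + 1) (by omega)
  have hN2' := hN2 m (by omega)
  have hP2' := hP2 m (by omega)
  rw [← hN] at hN1' hN2'
  rw [← hP] at hP1' hP2'
  have hd : R.degree < s.card := by
    rw [hm, degree_lt_iff_coeff_zero]
    intro j hj
    obtain ⟨j, rfl⟩ := Nat.exists_eq_add_of_le' (show 1 ≤ j by omega)
    rw [hR, coeff_sub, coeff_X_mul, coeff_C_mul, coeff_sub]
    rcases Nat.lt_trichotomy j (m + 1) with h | rfl | h
    · omega
    · rw [hN0', hP1', hN1', hc]; ring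
    · rw [coeff_eq_zero_of_natDegree_lt (show N.natDegree < j + 1 by omega)]
      rcases Nat.lt_trichotomy j (m + 2) with h | rfl | h
      · omega
      · rw [hN0', hP0']; ring
      · rw [coeff_eq_zero_of_natDegree_lt (show N.natDegree < j by omega),
          coeff_eq_zero_of_natDegree_lt (show P.natDegree < j by omega)]; ring
  have h3 : ∀ i ∈ s, R.eval (v i) = v i * ∏ j ∈ t, (v i - w j) := by
    intro i hi
    simp [hR, hP, hN, eval_prod, Finset.prod_eq_zero hi]
  have := Lagrange.coeff_eq_sum hv hd
  rw [Finset.sum_congr rfl fun i hi => by rw [h3 i hi], show s.card - 1 = m + 1 by omega, hR,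
    coeff_sub, coeff_X_mul, coeff_C_mul, coeff_sub, hN1'] at this
  rw [← this]
  linear_combination (1 / 2) * hP2' - (1 / 2) * hN2'

theorem disjSum_erase_inl {κ : Type*} [DecidableEq κ] (s : Finset ι) (t : Finset κ) (i : ι) :
    (s.disjSum t).erase (Sum.inl i) = (s.erase i).disjSum t := by
  ext (a | a) <;> simp

theorem disjSum_erase_inr {κ : Type*} [DecidableEq κ] (s : Finset ι) (t : Finset κ) (i : κ) :
    (s.disjSum t).erase (Sum.inr i) = s.disjSum (t.erase i) := by
  ext (a | a) <;> simp

/-- The residues of `∏ (u - y_j) ∏ (u + 1 - z_j) / ∏ (u - x_j) (u + 1 - x_j)` at its poles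
`x_i` and `x_i - 1`, weighted with the values of `g`. -/
theorem sum_residues (s : Finset ι) (x : ι → ℂ) (t t' : Finset κ) (y z : κ → ℂ) (g : ℂ → ℂ) :
    ∑ i ∈ s, (g (x i) * ((∏ j ∈ t, (x i - y j)) * ∏ j ∈ t', (x i + 1 - z j)) /
        ((∏ j ∈ s.erase i, (x i - x j)) * ∏ j ∈ s.erase i, (x i + 1 - x j)) -
      g (x i - 1) * ((∏ j ∈ t, (x i - 1 - y j)) * ∏ j ∈ t', (x i - z j)) /
        ((∏ j ∈ s.erase i, (x i - x j)) * ∏ j ∈ s.erase i, (x i - 1 - x j))) =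
    ∑ p ∈ s.disjSum s, g (Sum.elim x (fun i => x i - 1) p) *
      (∏ q ∈ t.disjSum t', (Sum.elim x (fun i => x i - 1) p - Sum.elim y (fun j => z j - 1) q)) /
      ∏ q ∈ (s.disjSum s).erase p,
        (Sum.elim x (fun i => x i - 1) p - Sum.elim x (fun i => x i - 1) q) := by
  rw [Finset.sum_disjSum, ← Finset.sum_add_distrib]
  refine Finset.sum_congr rfl fun i hi => ?_
  rw [disjSum_erase_inl, disjSum_erase_inr]
  simp only [Finset.prod_disjSum, Sum.elim_inl, Sum.elim_inr]
  have h1 : ∏ j ∈ s, (x i - (x j - 1)) = ∏ j ∈ s.erase i, (x i + 1 - x j) := by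
    rw [← Finset.mul_prod_erase s _ hi]
    simp only [sub_sub_cancel, one_mul]
    exact Finset.prod_congr rfl fun j _ => by ring
  -- The factor `j = i` equals -1: this is the minus sign between the two families of residues.
  have h2 : ∏ j ∈ s, (x i - 1 - x j) = -∏ j ∈ s.erase i, (x i - 1 - x j) := by
    rw [← Finset.mul_prod_erase s _ hi]; ring
  have h3 : ∏ j ∈ s.erase i, (x i - 1 - (x j - 1)) = ∏ j ∈ s.erase i, (x i - x j) :=
    Finset.prod_congr rfl fun j _ => by ring
  have h4 : ∏ j ∈ t', (x i - (z j - 1)) = ∏ j ∈ t', (x i + 1 - z j) :=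
    Finset.prod_congr rfl fun j _ => by ring
  have h5 : ∏ j ∈ t', (x i - 1 - (z j - 1)) = ∏ j ∈ t', (x i - z j) :=
    Finset.prod_congr rfl fun j _ => by ring
  rw [h1, h2, h3, h4, h5, neg_mul, div_neg, mul_comm (∏ j ∈ s.erase i, (x i - 1 - x j)),
    sub_eq_add_neg]

/-- Genericity makes the poles `x i` and `x i - 1` pairwise distinct, as interpolation requires. -/
theorem injOn_elim_sub_one (s : Finset ι) (x : ι → ℂ)
    (hx : ∀ i ∈ s, ∀ j ∈ s, i ≠ j → ∀ m : ℤ, x i - x j ≠ m) :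
    Set.InjOn (Sum.elim x fun i => x i - 1) (s.disjSum s : Finset (ι ⊕ ι)) := by
  rintro (i | i) hi (j | j) hj h <;> simp only [Finset.mem_coe, Finset.inl_mem_disjSum,
    Finset.inr_mem_disjSum, Sum.elim_inl, Sum.elim_inr] at hi hj h <;> by_cases hij : i = j
  · rw [hij]
  · exact absurd (by rw [h]; simp) (hx i hi j hj hij 0)
  · subst hij; exact absurd (by linear_combination h) (one_ne_zero (α := ℂ))
  · exact absurd (by rw [h]; push_cast; ring) (hx i hi j hj hij (-1))
  · subst hij; exact absurd (by linear_combination -h) (one_ne_zero (α := ℂ))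
  · exact absurd (by rw [← h]; push_cast; ring) (hx i hi j hj hij 1)
  · rw [hij]
  · exact absurd (by rw [sub_left_inj.1 h]; simp) (hx i hi j hj hij 0)

theorem sum_residues_one (s : Finset ι) (x : ι → ℂ) (t t' : Finset κ) (y z : κ → ℂ)
    (hx : ∀ i ∈ s, ∀ j ∈ s, i ≠ j → ∀ m : ℤ, x i - x j ≠ m)
    (hs : s.Nonempty) (ht : t.card = s.card + 1) (ht' : t'.card + 1 = s.card) :
    ∑ i ∈ s, (((∏ j ∈ t, (x i - y j)) * ∏ j ∈ t', (x i + 1 - z j)) /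
        ((∏ j ∈ s.erase i, (x i - x j)) * ∏ j ∈ s.erase i, (x i + 1 - x j)) -
      ((∏ j ∈ t, (x i - 1 - y j)) * ∏ j ∈ t', (x i - z j)) /
        ((∏ j ∈ s.erase i, (x i - x j)) * ∏ j ∈ s.erase i, (x i - 1 - x j))) =
    2 * ∑ i ∈ s, x i - ∑ j ∈ t, y j - ∑ j ∈ t', z j - 1 := by
  have := sum_residues s x t t' y z fun _ => 1
  simp only [one_mul] at this
  rw [this, sum_eval_div_prod_sub _ _ _ _ (injOn_elim_sub_one s x hx)
    (by simp only [Finset.card_disjSum]; omega) (hs.elim fun i hi => ⟨Sum.inl i, by simpa using hi⟩)]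
  simp only [Finset.sum_disjSum, Sum.elim_inl, Sum.elim_inr, Finset.sum_sub_distrib,
    Finset.sum_const, nsmul_eq_mul, mul_one, ← ht']
  push_cast
  ring

theorem sum_residues_id (s : Finset ι) (x : ι → ℂ) (t t' : Finset κ) (y z : κ → ℂ)
    (hx : ∀ i ∈ s, ∀ j ∈ s, i ≠ j → ∀ m : ℤ, x i - x j ≠ m)
    (hs : s.Nonempty) (ht : t.card = s.card + 1) (ht' : t'.card + 1 = s.card) :
    ∑ i ∈ s, (x i * ((∏ j ∈ t, (x i - y j)) * ∏ j ∈ t', (x i + 1 - z j)) /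
        ((∏ j ∈ s.erase i, (x i - x j)) * ∏ j ∈ s.erase i, (x i + 1 - x j)) -
      (x i - 1) * ((∏ j ∈ t, (x i - 1 - y j)) * ∏ j ∈ t', (x i - z j)) /
        ((∏ j ∈ s.erase i, (x i - x j)) * ∏ j ∈ s.erase i, (x i - 1 - x j))) =
    ((2 * ∑ i ∈ s, x i - ∑ j ∈ t, y j - ∑ j ∈ t', z j - 1) ^ 2 +
      (2 * ∑ i ∈ s, x i ^ 2 - ∑ j ∈ t, y j ^ 2 - ∑ j ∈ t', z j ^ 2
        - 2 * ∑ i ∈ s, x i + 2 * ∑ j ∈ t', z j + 1)) / 2 := by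
  have := sum_residues s x t t' y z id
  simp only [id] at this
  have hpos := hs.card_pos
  rw [this, sum_mul_eval_div_prod_sub _ _ _ _ (injOn_elim_sub_one s x hx)
    (by simp only [Finset.card_disjSum]; omega) (by simp only [Finset.card_disjSum]; omega)]
  simp only [Finset.sum_disjSum, Sum.elim_inl, Sum.elim_inr, Finset.sum_sub_distrib, sub_sq,
    Finset.sum_add_distrib, ← Finset.mul_sum, one_pow,
    Finset.sum_const, nsmul_eq_mul, mul_one, ← ht']
  push_cast
  ring

end Interpolation

/-! ### Operators that shift one entry of a row, and their commutators. -/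

section Operators

variable {n : ℕ} {L : Tableau n}

theorem entry_shift_self (R : tableauSet L) {k i : ℕ} (hk : k < n) (c : ℤ)
    (hi : i ∈ Finset.Icc 1 k) : (shift R k i hk c).1.entry k i = R.1.entry k i + c := by
  rw [Finset.mem_Icc] at hi
  simp [shift, Tableau.entry, Tableau.translate, delta, hi.1, hi.2, hk.le]

theorem entry_shift_of_ne (R : tableauSet L) {k i : ℕ} (hk : k < n) (c : ℤ) {k' i' : ℕ}
    (h : (k', i') ≠ (k, i)) : (shift R k i hk c).1.entry k' i' = R.1.entry k' i' := by
  simp only [shift, Tableau.entry, Tableau.translate]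
  split_ifs <;> simp [delta, h]

theorem entry_shift_row_ne (R : tableauSet L) {k i : ℕ} (hk : k < n) (c : ℤ) {k' : ℕ} (i' : ℕ)
    (h : k' ≠ k) : (shift R k i hk c).1.entry k' i' = R.1.entry k' i' :=
  entry_shift_of_ne R hk c (by simp [h])

theorem entry_shift_col_ne (R : tableauSet L) {k i : ℕ} (hk : k < n) (c : ℤ) {i' : ℕ}
    (h : i' ≠ i) : (shift R k i hk c).1.entry k i' = R.1.entry k i' :=
  entry_shift_of_ne R hk c (by simp [h])

theorem shift_comm (R : tableauSet L) {k i k' i' : ℕ} (hk : k < n) (hk' : k' < n) (c c' : ℤ) :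
    shift (shift R k i hk c) k' i' hk' c' = shift (shift R k' i' hk' c') k i hk c := by
  apply Subtype.ext
  funext p
  simp only [shift, Tableau.translate]
  ring

theorem shift_shift (R : tableauSet L) {k i : ℕ} (hk : k < n) (c c' : ℤ) :
    shift (shift R k i hk c) k i hk c' = shift R k i hk (c + c') := by
  apply Subtype.ext
  funext p
  simp only [shift, Tableau.translate, add_smul, Pi.add_apply]
  push_cast
  ring

theorem shift_zero (R : tableauSet L) {k i : ℕ} (hk : k < n) : shift R k i hk 0 = R := by
  apply Subtype.ext
  funext p
  simp [shift, Tableau.translate]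

theorem entry_sub_ne_intCast (hL : IsGeneric L) (R : tableauSet L) {k i j : ℕ} (hk : k < n)
    (hi : i ∈ Finset.Icc 1 k) (hj : j ∈ Finset.Icc 1 k) (hij : i ≠ j) (m : ℤ) :
    R.1.entry k i - R.1.entry k j ≠ m := by
  obtain ⟨R, z, hz, rfl⟩ := R
  rw [Finset.mem_Icc] at hi hj
  have hi' : 1 ≤ i ∧ i ≤ k ∧ k ≤ n := ⟨hi.1, hi.2, hk.le⟩
  have hj' : 1 ≤ j ∧ j ≤ k ∧ k ≤ n := ⟨hj.1, hj.2, hk.le⟩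
  intro h
  refine hL k i j hk hi.1 hi.2 hj.1 hj.2 hij (m - z ⟨(k, i), hi'⟩ + z ⟨(k, j), hj'⟩) ?_
  simp only [Tableau.entry, Tableau.translate, hi', hj', and_self, dite_true] at h ⊢
  push_cast
  linear_combination h

/-- The linear map sending `T(R)` to `∑ i, c i R • T(R + ε δ^{ki})`. -/
noncomputable def rowOp (k : ℕ) (hk : k < n) (ε : ℤ) (c : ℕ → tableauSet L → ℂ) :
    Module.End ℂ (V L) :=
  (tableauBasis L).constr ℂ fun R => ∑ i ∈ Finset.Icc 1 k, c i R • basisVec (shift R k i hk ε)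

/-- The linear map acting on `T(R)` by the scalar `d R`. -/
noncomputable def diagOp (d : tableauSet L → ℂ) : Module.End ℂ (V L) :=
  (tableauBasis L).constr ℂ fun R => d R • basisVec R

@[simp]
theorem rowOp_basisVec (k : ℕ) (hk : k < n) (ε : ℤ) (c : ℕ → tableauSet L → ℂ)
    (R : tableauSet L) : rowOp k hk ε c (basisVec R) =
      ∑ i ∈ Finset.Icc 1 k, c i R • basisVec (shift R k i hk ε) :=
  (tableauBasis L).constr_basis ℂ _ R

@[simp]
theorem diagOp_basisVec (d : tableauSet L → ℂ) (R : tableauSet L) :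
    diagOp d (basisVec R) = d R • basisVec R :=
  (tableauBasis L).constr_basis ℂ _ R

theorem end_ext {M : Type*} [AddCommGroup M] [Module ℂ M] {a b : V L →ₗ[ℂ] M}
    (h : ∀ R : tableauSet L, a (basisVec R) = b (basisVec R)) : a = b :=
  (tableauBasis L).ext h

theorem rowOp_rowOp_basisVec (k k' : ℕ) (hk : k < n) (hk' : k' < n) (ε ε' : ℤ)
    (c c' : ℕ → tableauSet L → ℂ) (R : tableauSet L) :
    rowOp k hk ε c (rowOp k' hk' ε' c' (basisVec R)) =
      ∑ j ∈ Finset.Icc 1 k', ∑ i ∈ Finset.Icc 1 k, (c' j R * c i (shift R k' j hk' ε')) •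
        basisVec (shift (shift R k' j hk' ε') k i hk ε) := by
  simp only [rowOp_basisVec, map_sum, map_smul, Finset.smul_sum, mul_smul]

theorem rowOp_lie_eq_zero {k k' : ℕ} (hk : k < n) (hk' : k' < n) (ε ε' : ℤ)
    (c c' : ℕ → tableauSet L → ℂ)
    (h : ∀ R, ∀ i ∈ Finset.Icc 1 k, ∀ j ∈ Finset.Icc 1 k',
      c' j R * c i (shift R k' j hk' ε') = c i R * c' j (shift R k i hk ε)) :
    ⁅rowOp k hk ε c, rowOp k' hk' ε' c'⁆ = 0 := by
  rw [Ring.lie_def, sub_eq_zero]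
  refine end_ext fun R => ?_
  rw [Module.End.mul_apply, Module.End.mul_apply, rowOp_rowOp_basisVec, rowOp_rowOp_basisVec,
    Finset.sum_comm]
  refine Finset.sum_congr rfl fun i hi => Finset.sum_congr rfl fun j hj => ?_
  rw [h R i hi j hj, shift_comm]

theorem sum_sum_eq_zero_of_antisymm {ι M : Type*} [AddCommGroup M] [Module ℂ M] (s : Finset ι)
    (F : ι → ι → M) (h : ∀ i ∈ s, ∀ j ∈ s, F i j + F j i = 0) : ∑ i ∈ s, ∑ j ∈ s, F i j = 0 := by
  have h2 : (2 : ℂ) • ∑ i ∈ s, ∑ j ∈ s, F i j = 0 := by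
    rw [two_smul]
    nth_rewrite 2 [Finset.sum_comm]
    simp only [← Finset.sum_add_distrib]
    exact Finset.sum_eq_zero fun i hi => Finset.sum_eq_zero fun j hj => h i hi j hj
  simpa using h2

/-- The coefficient of `T(R + ε δ^{ki} + ε δ^{ki'} + ε δ^{mj})` in the image of `T(R)` under the
double commutator `a²b - 2aba + ba²` of two row operators. -/
noncomputable def serreCoeff {k m : ℕ} (hk : k < n) (hm : m < n) (ε : ℤ)
    (c c' : ℕ → tableauSet L → ℂ) (R : tableauSet L) (j i i' : ℕ) : ℂ :=
  c' j R * c i (shift R m j hm ε) * c i' (shift (shift R m j hm ε) k i hk ε)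
    - 2 * (c i R * c' j (shift R k i hk ε) * c i' (shift (shift R m j hm ε) k i hk ε))
    + c i R * c i' (shift R k i hk ε) * c' j (shift (shift R k i hk ε) k i' hk ε)

theorem rowOp_lie_lie_eq_zero {k m : ℕ} (hk : k < n) (hm : m < n) (ε : ℤ)
    (c c' : ℕ → tableauSet L → ℂ)
    (h : ∀ R, ∀ j ∈ Finset.Icc 1 m, ∀ i ∈ Finset.Icc 1 k, ∀ i' ∈ Finset.Icc 1 k,
      serreCoeff hk hm ε c c' R j i i' + serreCoeff hk hm ε c c' R j i' i = 0) :
    ⁅rowOp k hk ε c, ⁅rowOp k hk ε c, rowOp m hm ε c'⁆⁆ = 0 := by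
  set a := rowOp k hk ε c with ha
  set b := rowOp m hm ε c' with hb
  have key : ∀ R, a (a (b (basisVec R))) - (2 : ℂ) • a (b (a (basisVec R))) +
      b (a (a (basisVec R))) = 0 := by
    intro R
    have h1 : a (a (b (basisVec R))) = ∑ j ∈ Finset.Icc 1 m, ∑ i ∈ Finset.Icc 1 k,
        ∑ i' ∈ Finset.Icc 1 k, (c' j R * c i (shift R m j hm ε) *
          c i' (shift (shift R m j hm ε) k i hk ε)) •
          basisVec (shift (shift (shift R m j hm ε) k i hk ε) k i' hk ε) := by
      simp only [ha, hb, rowOp_basisVec, map_sum, map_smul, Finset.smul_sum, mul_smul]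
    have h2 : a (b (a (basisVec R))) = ∑ j ∈ Finset.Icc 1 m, ∑ i ∈ Finset.Icc 1 k,
        ∑ i' ∈ Finset.Icc 1 k, (c i R * c' j (shift R k i hk ε) *
          c i' (shift (shift R m j hm ε) k i hk ε)) •
          basisVec (shift (shift (shift R m j hm ε) k i hk ε) k i' hk ε) := by
      rw [Finset.sum_comm]
      simp only [ha, hb, rowOp_basisVec, map_sum, map_smul, Finset.smul_sum, mul_smul]
      refine Finset.sum_congr rfl fun i _ => Finset.sum_congr rfl fun j _ =>
        Finset.sum_congr rfl fun i' _ => ?_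
      rw [shift_comm R hk hm]
    have h3 : b (a (a (basisVec R))) = ∑ j ∈ Finset.Icc 1 m, ∑ i ∈ Finset.Icc 1 k,
        ∑ i' ∈ Finset.Icc 1 k, (c i R * c i' (shift R k i hk ε) *
          c' j (shift (shift R k i hk ε) k i' hk ε)) •
          basisVec (shift (shift (shift R m j hm ε) k i hk ε) k i' hk ε) := by
      rw [Finset.sum_comm]
      simp only [ha, hb, rowOp_basisVec, map_sum, map_smul, Finset.smul_sum, mul_smul]
      refine Finset.sum_congr rfl fun i _ => ?_
      rw [Finset.sum_comm]
      refine Finset.sum_congr rfl fun j _ => Finset.sum_congr rfl fun i' _ => ?_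
      rw [shift_comm R hm hk, shift_comm (shift R k i hk ε) hm hk]
    rw [h1, h2, h3]
    simp only [Finset.smul_sum, ← Finset.sum_sub_distrib, ← Finset.sum_add_distrib]
    -- Moving `i` and `i'` in either order gives the same tableau, so only the symmetrised
    -- coefficient has to vanish.
    refine Finset.sum_eq_zero fun j hj => sum_sum_eq_zero_of_antisymm _ _ fun i hi i' hi' => ?_
    have h4 := h R j hj i hi i' hi'
    rw [shift_comm _ (i := i') (i' := i) hk hk]
    simp only [serreCoeff] at h4
    simp only [← mul_smul, ← sub_smul, ← add_smul]
    rw [h4, zero_smul]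
  refine end_ext fun R => ?_
  have := key R
  simp only [Ring.lie_def, LinearMap.sub_apply, Module.End.mul_apply, map_sub,
    LinearMap.zero_apply]
  rw [← this]
  module

theorem diagOp_lie_diagOp (d d' : tableauSet L → ℂ) : ⁅diagOp d, diagOp d'⁆ = 0 := by
  rw [Ring.lie_def, sub_eq_zero]
  refine end_ext fun R => ?_
  simp [smul_smul, mul_comm]

theorem diagOp_lie_rowOp (d : tableauSet L → ℂ) {k : ℕ} (hk : k < n) (ε : ℤ)
    (c : ℕ → tableauSet L → ℂ) : ⁅diagOp d, rowOp k hk ε c⁆ =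
      rowOp k hk ε fun i R => (d (shift R k i hk ε) - d R) * c i R := by
  rw [Ring.lie_def]
  refine end_ext fun R => ?_
  simp only [LinearMap.sub_apply, Module.End.mul_apply, rowOp_basisVec, diagOp_basisVec, map_sum,
    map_smul, Finset.smul_sum, ← Finset.sum_sub_distrib]
  refine Finset.sum_congr rfl fun i _ => ?_
  module

theorem rowOp_congr {k : ℕ} (hk : k < n) (ε : ℤ) {c c' : ℕ → tableauSet L → ℂ}
    (h : ∀ i ∈ Finset.Icc 1 k, ∀ R, c i R = c' i R) : rowOp k hk ε c = rowOp k hk ε c' := by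
  refine end_ext fun R => ?_
  rw [rowOp_basisVec, rowOp_basisVec]
  exact Finset.sum_congr rfl fun i hi => by rw [h i hi R]

theorem rowOp_smul {k : ℕ} (hk : k < n) (ε : ℤ) (a : ℂ) (c : ℕ → tableauSet L → ℂ) :
    (rowOp k hk ε fun i R => a * c i R) = a • rowOp k hk ε c := by
  refine end_ext fun R => ?_
  simp [Finset.smul_sum, mul_smul]

/-! ### Coefficients of the formulas under shifts, and the relations they imply. -/

/-- The coefficient `∏_{j ∈ s} (r_{ki} - r_{mj}) / ∏_{j ≠ i} (r_{ki} - r_{kj})`. -/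
noncomputable def rowCoeff (k m : ℕ) (s : Finset ℕ) (i : ℕ) (R : tableauSet L) : ℂ :=
  (∏ j ∈ s, (R.1.entry k i - R.1.entry m j)) /
    ∏ j ∈ (Finset.Icc 1 k).erase i, (R.1.entry k i - R.1.entry k j)

theorem raiseCoeff_eq (R : tableauSet L) (k i : ℕ) :
    raiseCoeff R.1 k i = -1 * rowCoeff k (k + 1) (Finset.Icc 1 (k + 1)) i R := by
  rw [neg_one_mul]; rfl

theorem rowCoeff_erase (k m : ℕ) {s : Finset ℕ} {j : ℕ} (hj : j ∈ s) (i : ℕ)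
    (R : tableauSet L) : rowCoeff k m s i R =
      (R.1.entry k i - R.1.entry m j) * rowCoeff k m (s.erase j) i R := by
  rw [rowCoeff, rowCoeff, ← Finset.mul_prod_erase s _ hj, mul_div_assoc]

theorem rowCoeff_shift_of_ne {k m k' : ℕ} (s : Finset ℕ) (i : ℕ) (R : tableauSet L) (j : ℕ)
    (hk' : k' < n) (ε : ℤ) (h1 : k ≠ k') (h2 : m ≠ k') :
    rowCoeff k m s i (shift R k' j hk' ε) = rowCoeff k m s i R := by
  simp only [rowCoeff, entry_shift_row_ne R hk' ε _ h1, entry_shift_row_ne R hk' ε _ h2]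

theorem rowCoeff_shift_notMem {k m : ℕ} {s : Finset ℕ} (i : ℕ) (R : tableauSet L) {j : ℕ}
    (hm : m < n) (ε : ℤ) (h1 : k ≠ m) (hj : j ∉ s) :
    rowCoeff k m s i (shift R m j hm ε) = rowCoeff k m s i R := by
  simp only [rowCoeff, entry_shift_row_ne R hm ε _ h1]
  congr 1
  exact Finset.prod_congr rfl fun j' hj' =>
    by rw [entry_shift_col_ne R hm ε (by rintro rfl; exact hj hj')]

theorem rowCoeff_shift_mem {k m : ℕ} {s : Finset ℕ} (i : ℕ) (R : tableauSet L) {j : ℕ}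
    (hm : m < n) (ε : ℤ) (h1 : k ≠ m) (hj : j ∈ s) (hjm : j ∈ Finset.Icc 1 m) :
    rowCoeff k m s i (shift R m j hm ε) =
      (R.1.entry k i - R.1.entry m j - ε) * rowCoeff k m (s.erase j) i R := by
  rw [rowCoeff_erase k m hj, rowCoeff_shift_notMem i R hm ε h1 (Finset.notMem_erase j s),
    entry_shift_row_ne R hm ε _ h1, entry_shift_self R hm ε hjm]
  ring

/-- Only the denominator factor at `i` moves; genericity makes its old value nonzero, so it can be
exchanged for the new one. -/
theorem rowCoeff_shift_col_ne (hL : IsGeneric L) {k m : ℕ} (s : Finset ℕ) {i i' : ℕ}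
    (R : tableauSet L) (hk : k < n) (ε : ℤ) (h1 : m ≠ k) (hi : i ∈ Finset.Icc 1 k)
    (hi' : i' ∈ Finset.Icc 1 k) (hii' : i' ≠ i) :
    rowCoeff k m s i' (shift R k i hk ε) = rowCoeff k m s i' R *
      ((R.1.entry k i' - R.1.entry k i) / (R.1.entry k i' - R.1.entry k i - ε)) := by
  have hne := entry_sub_ne_intCast hL R hk hi' hi hii' 0
  have hmem : i ∈ (Finset.Icc 1 k).erase i' := Finset.mem_erase.2 ⟨hii'.symm, hi⟩
  rw [Int.cast_zero] at hne
  rw [rowCoeff, rowCoeff, ← Finset.mul_prod_erase _ _ hmem, ← Finset.mul_prod_erase _ _ hmem,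
    entry_shift_col_ne R hk ε hii', entry_shift_self R hk ε hi]
  simp only [entry_shift_row_ne R hk ε _ h1]
  have hprod : ∏ x ∈ ((Finset.Icc 1 k).erase i').erase i,
      (R.1.entry k i' - (shift R k i hk ε).1.entry k x) =
      ∏ x ∈ ((Finset.Icc 1 k).erase i').erase i, (R.1.entry k i' - R.1.entry k x) :=
    Finset.prod_congr rfl fun x hx => by
      rw [entry_shift_col_ne R hk ε (Finset.ne_of_mem_erase hx)]
  rw [hprod, div_mul_div_comm, mul_comm _ (R.1.entry k i' - R.1.entry k i), mul_assoc
    (R.1.entry k i' - R.1.entry k i), mul_div_mul_left _ _ hne]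
  congr 1
  ring

theorem rowCoeff_shift_self {k m : ℕ} (s : Finset ℕ) {i : ℕ} (R : tableauSet L) (hk : k < n)
    (ε : ℤ) (h1 : m ≠ k) (hi : i ∈ Finset.Icc 1 k) :
    rowCoeff k m s i (shift R k i hk ε) = (∏ j ∈ s, (R.1.entry k i + ε - R.1.entry m j)) /
      ∏ j ∈ (Finset.Icc 1 k).erase i, (R.1.entry k i + ε - R.1.entry k j) := by
  rw [rowCoeff, entry_shift_self R hk ε hi]
  simp only [entry_shift_row_ne R hk ε _ h1]
  congr 1
  exact Finset.prod_congr rfl fun j hj => by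
    rw [entry_shift_col_ne R hk ε (Finset.ne_of_mem_erase hj)]

theorem rowOp_lie_of_disjoint {k k' m m' : ℕ} (s s' : Finset ℕ) (hk : k < n) (hk' : k' < n)
    (ε ε' : ℤ) (h1 : k ≠ k') (h2 : k ≠ m') (h3 : k' ≠ m) :
    ⁅rowOp (L := L) k hk ε (rowCoeff k m s), rowOp (L := L) k' hk' ε' (rowCoeff k' m' s')⁆ = 0 := by
  refine rowOp_lie_eq_zero hk hk' ε ε' _ _ fun R i _ j _ => ?_
  rw [rowCoeff_shift_of_ne s i R j hk' ε' h1 h3.symm,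
    rowCoeff_shift_of_ne s' j R i hk ε h1.symm h2.symm, mul_comm]

/-- The coefficients interact only through `r_{ki} - r_{mj}` and its negative, and both orders give
the same product of shifted factors. -/
theorem rowOp_lie_opposite {k m : ℕ} (hk : k < n) (hm : m < n) (h : k ≠ m) :
    ⁅rowOp (L := L) k hk 1 (rowCoeff k m (Finset.Icc 1 m)),
      rowOp (L := L) m hm (-1) (rowCoeff m k (Finset.Icc 1 k))⁆ = 0 := by
  refine rowOp_lie_eq_zero hk hm _ _ _ _ fun R i hi j hj => ?_
  rw [rowCoeff_shift_mem i R hm _ h hj hj, rowCoeff_shift_mem j R hk _ h.symm hi hi,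
    rowCoeff_erase k m hj, rowCoeff_erase m k hi]
  push_cast
  ring

/-- For fixed `j`, the row `m` shift affects a coefficient of row `k` only through the factor
`r_{ki} - r_{mj}`. With this factor split off, a rational identity in the two moving entries
remains. Raising and lowering are both covered, by taking `m` above or below `k`. -/
theorem rowOp_serre_left (hL : IsGeneric L) {k m l : ℕ} (s : Finset ℕ) (hk : k < n) (hm : m < n)
    (ε : ℤ) (hkm : k ≠ m) (hkl : k ≠ l) :
    ⁅rowOp (L := L) k hk ε (rowCoeff k m (Finset.Icc 1 m)),
      ⁅rowOp (L := L) k hk ε (rowCoeff k m (Finset.Icc 1 m)),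
        rowOp (L := L) m hm ε (rowCoeff m l s)⁆⁆ = 0 := by
  refine rowOp_lie_lie_eq_zero hk hm ε _ _ fun R j hj => ?_
  have h1 : ∀ i, rowCoeff k m (Finset.Icc 1 m) i R = _ := fun i => rowCoeff_erase k m hj i R
  have h2 : ∀ i, rowCoeff k m (Finset.Icc 1 m) i (shift R m j hm ε) = _ :=
    fun i => rowCoeff_shift_mem i R hm ε hkm hj hj
  have h3 : ∀ i, i ∈ Finset.Icc 1 k → ∀ i' ∈ Finset.Icc 1 k,
      rowCoeff k m (Finset.Icc 1 m) i' (shift (shift R m j hm ε) k i hk ε) =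
        ((shift R k i hk ε).1.entry k i' - (shift R k i hk ε).1.entry m j - ε) *
          rowCoeff k m ((Finset.Icc 1 m).erase j) i' (shift R k i hk ε) := by
    intro i hi i' hi'
    rw [shift_comm R hm hk]
    exact rowCoeff_shift_mem i' (shift R k i hk ε) hm ε hkm hj hj
  have h4 : ∀ i i', rowCoeff k m (Finset.Icc 1 m) i' (shift R k i hk ε) =
      ((shift R k i hk ε).1.entry k i' - (shift R k i hk ε).1.entry m j) *
        rowCoeff k m ((Finset.Icc 1 m).erase j) i' (shift R k i hk ε) :=
    fun i i' => rowCoeff_erase k m hj i' (shift R k i hk ε)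
  have h5 : ∀ i (R : tableauSet L), rowCoeff m l s j (shift R k i hk ε) = rowCoeff m l s j R :=
    fun i R => rowCoeff_shift_of_ne s j R i hk ε hkm.symm hkl.symm
  intro i hi i' hi'
  simp only [serreCoeff, h5, h1, h2, h4, h3 i hi i' hi', h3 i' hi' i hi,
    entry_shift_row_ne R hk ε _ hkm.symm]
  by_cases hii' : i = i'
  · subst hii'
    rw [entry_shift_self R hk ε hi]
    ring
  · rw [entry_shift_col_ne R hk ε (Ne.symm hii'), entry_shift_col_ne R hk ε hii',
      rowCoeff_shift_col_ne hL _ R hk ε hkm.symm hi hi' (Ne.symm hii'),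
      rowCoeff_shift_col_ne hL _ R hk ε hkm.symm hi' hi hii']
    have h6 : R.1.entry k i' - R.1.entry k i - ε ≠ 0 :=
      sub_ne_zero.2 (entry_sub_ne_intCast hL R hk hi' hi (Ne.symm hii') ε)
    have h7 : R.1.entry k i - R.1.entry k i' - ε ≠ 0 :=
      sub_ne_zero.2 (entry_sub_ne_intCast hL R hk hi hi' hii' ε)
    generalize rowCoeff m l s j R = a
    generalize rowCoeff k m _ i R = b
    generalize rowCoeff k m _ i' R = b'
    field_simp
    ring

/-- Here the doubled operator moves two entries of row `m`; their two factors are split off from the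
row `k` coefficient. -/
theorem rowOp_serre_right (hL : IsGeneric L) {k m l : ℕ} (s : Finset ℕ) (hk : k < n) (hm : m < n)
    (ε : ℤ) (hkm : k ≠ m) (hkl : k ≠ l) (hml : m ≠ l) :
    ⁅rowOp (L := L) m hm ε (rowCoeff m l s), ⁅rowOp (L := L) m hm ε (rowCoeff m l s),
      rowOp (L := L) k hk ε (rowCoeff k m (Finset.Icc 1 m))⁆⁆ = 0 := by
  refine rowOp_lie_lie_eq_zero hm hk ε _ _ fun R i hi j hj j' hj' => ?_
  have h1 : ∀ j (R : tableauSet L), rowCoeff m l s j (shift R k i hk ε) = rowCoeff m l s j R :=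
    fun j R => rowCoeff_shift_of_ne s j R i hk ε hkm.symm hkl.symm
  simp only [serreCoeff, shift_comm R hk hm, h1]
  by_cases hjj' : j = j'
  · subst hjj'
    rw [shift_shift, rowCoeff_shift_mem i R hm _ hkm hj hj, rowCoeff_shift_mem i R hm _ hkm hj hj,
      rowCoeff_erase k m hj]
    push_cast
    ring
  · have hmem : j' ∈ (Finset.Icc 1 m).erase j := Finset.mem_erase.2 ⟨Ne.symm hjj', hj'⟩
    have hmem' : j ∈ (Finset.Icc 1 m).erase j' := Finset.mem_erase.2 ⟨hjj', hj⟩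
    have h2 : ∀ R : tableauSet L, rowCoeff k m (Finset.Icc 1 m) i R =
        (R.1.entry k i - R.1.entry m j) * ((R.1.entry k i - R.1.entry m j') *
          rowCoeff k m (((Finset.Icc 1 m).erase j).erase j') i R) := fun R => by
      rw [rowCoeff_erase k m hj, rowCoeff_erase k m hmem]
    have h3 : ∀ R : tableauSet L, rowCoeff k m (((Finset.Icc 1 m).erase j).erase j') i
        (shift R m j hm ε) = rowCoeff k m (((Finset.Icc 1 m).erase j).erase j') i R :=
      fun R => rowCoeff_shift_notMem i R hm ε hkm (by simp)
    have h4 : ∀ R : tableauSet L, rowCoeff k m (((Finset.Icc 1 m).erase j).erase j') i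
        (shift R m j' hm ε) = rowCoeff k m (((Finset.Icc 1 m).erase j).erase j') i R :=
      fun R => rowCoeff_shift_notMem i R hm ε hkm (by simp)
    simp only [h2, h3, h4, entry_shift_row_ne _ hm ε _ hkm, entry_shift_self _ hm ε hj,
      entry_shift_self _ hm ε hj', entry_shift_col_ne _ hm ε hjj',
      entry_shift_col_ne _ hm ε (Ne.symm hjj'),
      rowCoeff_shift_col_ne hL s R hm ε hml.symm hj hj' (Ne.symm hjj'),
      rowCoeff_shift_col_ne hL s R hm ε hml.symm hj' hj hjj']
    have h6 : R.1.entry m j' - R.1.entry m j - ε ≠ 0 :=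
      sub_ne_zero.2 (entry_sub_ne_intCast hL R hm hj' hj (Ne.symm hjj') ε)
    have h7 : R.1.entry m j - R.1.entry m j' - ε ≠ 0 :=
      sub_ne_zero.2 (entry_sub_ne_intCast hL R hm hj hj' hjj' ε)
    generalize rowCoeff k m _ i R = a
    generalize rowCoeff m l s j R = b
    generalize rowCoeff m l s j' R = b'
    field_simp
    ring

/-- The commutator of a weighted raising operator and a lowering operator in the same row is
diagonal. -/
theorem rowOp_lie_same_row (hL : IsGeneric L) {k m m' : ℕ} (s s' : Finset ℕ) (hk : k < n)
    (hm : m ≠ k) (hm' : m' ≠ k) (g : ℂ → ℂ) :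
    ⁅rowOp (L := L) k hk 1 (fun i R => g (R.1.entry k i) * rowCoeff k m s i R),
      rowOp (L := L) k hk (-1) (rowCoeff k m' s')⁆ = diagOp fun R => -∑ i ∈ Finset.Icc 1 k,
        (g (R.1.entry k i) * ((∏ j ∈ s, (R.1.entry k i - R.1.entry m j)) *
            ∏ j ∈ s', (R.1.entry k i + 1 - R.1.entry m' j)) /
          ((∏ j ∈ (Finset.Icc 1 k).erase i, (R.1.entry k i - R.1.entry k j)) *
            ∏ j ∈ (Finset.Icc 1 k).erase i, (R.1.entry k i + 1 - R.1.entry k j)) -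
        g (R.1.entry k i - 1) * ((∏ j ∈ s, (R.1.entry k i - 1 - R.1.entry m j)) *
            ∏ j ∈ s', (R.1.entry k i - R.1.entry m' j)) /
          ((∏ j ∈ (Finset.Icc 1 k).erase i, (R.1.entry k i - R.1.entry k j)) *
            ∏ j ∈ (Finset.Icc 1 k).erase i, (R.1.entry k i - 1 - R.1.entry k j))) := by
  rw [Ring.lie_def]
  refine end_ext fun R => ?_
  rw [LinearMap.sub_apply, Module.End.mul_apply, Module.End.mul_apply, rowOp_rowOp_basisVec,
    rowOp_rowOp_basisVec, Finset.sum_comm, ← Finset.sum_sub_distrib, diagOp_basisVec,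
    ← Finset.sum_neg_distrib, Finset.sum_smul]
  refine Finset.sum_congr rfl fun i hi => ?_
  rw [← Finset.sum_sub_distrib, Finset.sum_eq_single i]
  · simp only [shift_shift, neg_add_cancel, add_neg_cancel, shift_zero, ← sub_smul]
    congr 1
    rw [entry_shift_self R hk _ hi, rowCoeff_shift_self s R hk _ hm hi,
      rowCoeff_shift_self s' R hk _ hm' hi, rowCoeff, rowCoeff]
    push_cast
    simp only [← sub_eq_add_neg]
    simp only [div_eq_mul_inv, mul_inv]
    ring
  · intro j hj hji
    rw [shift_comm R hk hk, ← sub_smul, entry_shift_col_ne R hk _ hji.symm,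
      rowCoeff_shift_col_ne hL s R hk _ hm hj hi hji.symm,
      rowCoeff_shift_col_ne hL s' R hk _ hm' hi hj hji]
    have h6 := sub_ne_zero.2 (entry_sub_ne_intCast hL R hk hi hj hji.symm (-1))
    have h7 := sub_ne_zero.2 (entry_sub_ne_intCast hL R hk hj hi hji 1)
    -- The two orders of raising `i` and lowering `j` change the coefficients by the same ratio, so
    -- the off-diagonal terms cancel.
    have h8 : (R.1.entry k i - R.1.entry k j) / (R.1.entry k i - R.1.entry k j - (-1 : ℤ)) =
        (R.1.entry k j - R.1.entry k i) / (R.1.entry k j - R.1.entry k i - (1 : ℤ)) := by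
      rw [div_eq_div_iff h6 h7]; push_cast; ring
    rw [h8, sub_eq_zero.2 (by ring), zero_smul]
  · exact fun h => absurd hi h

theorem diagCoeff_shift (R : tableauSet L) {k i : ℕ} (hk : k < n) (hi : i ∈ Finset.Icc 1 k) (ε : ℤ)
    (k' : ℕ) (hk' : 1 ≤ k') : diagCoeff (shift R k i hk ε).1 k' - diagCoeff R.1 k' =
      ((if k' = k then ε else 0) - if k' = k + 1 then ε else 0 : ℤ) := by
  have hrow : ∑ j ∈ Finset.Icc 1 k, (shift R k i hk ε).1.entry k j =
      ∑ j ∈ Finset.Icc 1 k, R.1.entry k j + ε := by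
    rw [← Finset.add_sum_erase _ _ hi, ← Finset.add_sum_erase _ _ hi, entry_shift_self R hk ε hi,
      Finset.sum_congr rfl fun j hj => entry_shift_col_ne R hk ε (Finset.ne_of_mem_erase hj)]
    ring
  have hrow' : ∀ l, l ≠ k → ∑ j ∈ Finset.Icc 1 l, (shift R k i hk ε).1.entry l j =
      ∑ j ∈ Finset.Icc 1 l, R.1.entry l j := fun l hl =>
    Finset.sum_congr rfl fun j _ => entry_shift_row_ne R hk ε j hl
  simp only [diagCoeff]
  by_cases h1 : k' = k
  · subst h1
    rw [hrow, hrow' _ (by omega), if_pos rfl, if_neg (by omega)]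
    push_cast
    ring
  · by_cases h2 : k' = k + 1
    · subst h2
      rw [Nat.add_sub_cancel, hrow, hrow' _ h1, if_neg h1, if_pos rfl]
      push_cast
      ring
    · rw [hrow' _ h1, hrow' _ (by omega), if_neg h1, if_neg h2]
      simp

end Operators

/-! ### The module structure: existence and uniqueness. -/

section ModuleStructure

variable {n : ℕ}

/-- The raising operator `E_{k+1,k+2}` of the Gelfand–Tsetlin formulas. -/
noncomputable def gtRaise (L : Tableau n) (k : ℕ) : Module.End ℂ (V L) :=
  if hk : k + 1 < n then rowOp (k + 1) hk 1 fun i R => raiseCoeff R.1 (k + 1) i else 0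

/-- The lowering operator `E_{k+2,k+1}` of the Gelfand–Tsetlin formulas. -/
noncomputable def gtLower (L : Tableau n) (k : ℕ) : Module.End ℂ (V L) :=
  if hk : k + 1 < n then rowOp (k + 1) hk (-1) fun i R => lowerCoeff R.1 (k + 1) i else 0

/-- The diagonal operator `E_{k+1,k+1}` of the Gelfand–Tsetlin formulas. -/
noncomputable def gtDiag (L : Tableau n) (k : ℕ) : Module.End ℂ (V L) :=
  diagOp fun R => diagCoeff R.1 (k + 1)

variable {L : Tableau n}

theorem gtRaise_eq {k : ℕ} (hk : k + 1 < n) : gtRaise L k =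
    (-1 : ℂ) • rowOp (k + 1) hk 1 (rowCoeff (k + 1) (k + 2) (Finset.Icc 1 (k + 2))) := by
  rw [gtRaise, dif_pos hk, ← rowOp_smul]
  exact rowOp_congr hk 1 fun i _ R => raiseCoeff_eq R (k + 1) i

theorem gtLower_eq {k : ℕ} (hk : k + 1 < n) : gtLower L k =
    rowOp (k + 1) hk (-1) (rowCoeff (k + 1) k (Finset.Icc 1 k)) := by
  rw [gtLower, dif_pos hk]
  rfl

theorem gtDiag_lie_rowOp {k i : ℕ} (hk : k + 1 < n) (ε : ℤ) (c : ℕ → tableauSet L → ℂ) :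
    ⁅gtDiag L i, rowOp (k + 1) hk ε c⁆ =
      (((if i = k then ε else 0) - if i = k + 1 then ε else 0 : ℤ) : ℂ) •
        rowOp (k + 1) hk ε c := by
  rw [gtDiag, diagOp_lie_rowOp, ← rowOp_smul]
  refine rowOp_congr hk ε fun j hj R => ?_
  rw [diagCoeff_shift R hk hj ε (i + 1) (by omega)]
  simp only [Nat.add_right_cancel_iff]

theorem gtRaise_lie_gtLower_self (hL : IsGeneric L) {k : ℕ} (hk : k + 1 < n) :
    ⁅gtRaise L k, gtLower L k⁆ = gtDiag L k - gtDiag L (k + 1) := by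
  have h := rowOp_lie_same_row hL (m := k + 2) (m' := k) (Finset.Icc 1 (k + 2)) (Finset.Icc 1 k) hk
    (by omega) (by omega) fun _ => 1
  simp only [one_mul] at h
  rw [gtRaise_eq hk, gtLower_eq hk, smul_lie, h]
  refine end_ext fun R => ?_
  rw [LinearMap.smul_apply, diagOp_basisVec,
    sum_residues_one (Finset.Icc 1 (k + 1)) (R.1.entry (k + 1)) (Finset.Icc 1 (k + 2))
      (Finset.Icc 1 k) (R.1.entry (k + 2)) (R.1.entry k)
      (fun i hi j hj hij m => entry_sub_ne_intCast hL R hk hi hj hij m)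
      (by simp) (by simp) (by simp), LinearMap.sub_apply, gtDiag, gtDiag, diagOp_basisVec,
    diagOp_basisVec, ← sub_smul, ← mul_smul]
  congr 1
  simp only [diagCoeff, Nat.add_sub_cancel]
  push_cast
  ring

theorem serreRelations_gt (hL : IsGeneric L) :
    SerreRelations n (gtRaise L) (gtLower L) (gtDiag L) where
  hh i j _ _ := diagOp_lie_diagOp _ _
  he i k _ hk := by
    rw [gtRaise_eq hk, lie_smul, gtDiag_lie_rowOp hk]
    split_ifs <;> first | omega | simp
  hf i k _ hk := by
    rw [gtLower_eq hk, gtDiag_lie_rowOp hk]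
    split_ifs <;> first | omega | simp
  ef k l hk hl := by
    by_cases hkl : k = l
    · subst hkl
      rw [if_pos rfl, gtRaise_lie_gtLower_self hL hk]
    rw [if_neg hkl, gtRaise_eq hk, gtLower_eq hl, smul_lie]
    by_cases h1 : l = k + 1
    · subst h1
      rw [rowOp_lie_opposite hk hl (by omega), smul_zero]
    · rw [rowOp_lie_of_disjoint _ _ hk hl _ _ (by omega) (by omega) (by omega), smul_zero]
  ee k l hkl hl := by
    have hk : k + 1 < n := by omega
    rw [gtRaise_eq hk, gtRaise_eq hl, smul_lie, lie_smul,
      rowOp_lie_of_disjoint _ _ hk hl _ _ (by omega) (by omega) (by omega), smul_zero, smul_zero]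
  ff k l hkl hl := by
    have hk : k + 1 < n := by omega
    rw [gtLower_eq hk, gtLower_eq hl,
      rowOp_lie_of_disjoint _ _ hk hl _ _ (by omega) (by omega) (by omega)]
  eee k hk := by
    have hk' : k + 1 < n := by omega
    rw [gtRaise_eq hk', gtRaise_eq hk, smul_lie, smul_lie, lie_smul, lie_smul, lie_smul,
      rowOp_serre_left hL _ _ _ _ (by omega) (by omega)]
    simp
  eee' k hk := by
    have hk' : k + 1 < n := by omega
    rw [gtRaise_eq hk', gtRaise_eq hk, smul_lie, smul_lie, lie_smul, lie_smul, lie_smul,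
      rowOp_serre_right hL _ _ _ _ (by omega) (by omega) (by omega)]
    simp
  fff k hk := by
    have hk' : k + 1 < n := by omega
    rw [gtLower_eq hk', gtLower_eq hk,
      rowOp_serre_right hL _ _ _ _ (by omega) (by omega) (by omega)]
  fff' k hk := by
    have hk' : k + 1 < n := by omega
    rw [gtLower_eq hk', gtLower_eq hk, rowOp_serre_left hL _ _ _ _ (by omega) (by omega)]

theorem extendZero_univ {M : Type*} [AddCommGroup M] (t : ↥(Set.univ : Set (tableauSet L)) → M)
    (Q : tableauSet L) : extendZero t Q = t ⟨Q, trivial⟩ := by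
  simp [extendZero]

theorem isGTModuleStructure_iff (ρ : gl n →ₗ⁅ℂ⁆ Module.End ℂ (V L)) :
    IsGTModuleStructure L ρ ↔
      (∀ k, k + 1 < n → ρ (E n (k + 1) (k + 2)) = gtRaise L k) ∧
      (∀ k, k + 1 < n → ρ (E n (k + 2) (k + 1)) = gtLower L k) ∧
      (∀ k, k < n → ρ (E n (k + 1) (k + 1)) = gtDiag L k) := by
  constructor
  · rintro ⟨hr, hl, hd⟩
    refine ⟨fun k hk => end_ext fun R => ?_, fun k hk => end_ext fun R => ?_,
      fun k hk => end_ext fun R => ?_⟩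
    · rw [hr (k + 1) (by omega) hk ⟨R, trivial⟩, gtRaise, dif_pos hk, rowOp_basisVec]
      simp only [extendZero_univ]
    · rw [hl (k + 1) (by omega) hk ⟨R, trivial⟩, gtLower, dif_pos hk, rowOp_basisVec]
      simp only [extendZero_univ]
    · rw [hd (k + 1) (by omega) hk ⟨R, trivial⟩, gtDiag, diagOp_basisVec]
  · rintro ⟨hr, hl, hd⟩
    refine ⟨fun k h1 hk R => ?_, fun k h1 hk R => ?_, fun k h1 hk R => ?_⟩ <;>
      obtain ⟨k, rfl⟩ := Nat.exists_eq_add_of_le' h1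
    · rw [hr k hk, gtRaise, dif_pos hk, rowOp_basisVec]
      simp only [extendZero_univ]
    · rw [hl k hk, gtLower, dif_pos hk, rowOp_basisVec]
      simp only [extendZero_univ]
    · rw [hd k hk, gtDiag, diagOp_basisVec]

theorem existsUnique_isGTModuleStructure (hL : IsGeneric L) :
    ∃! ρ : gl n →ₗ⁅ℂ⁆ Module.End ℂ (V L), IsGTModuleStructure L ρ := by
  obtain ⟨ρ, hρ⟩ := (serreRelations_gt hL).exists_lieHom
  refine ⟨ρ, (isGTModuleStructure_iff ρ).2 hρ, fun ρ' hρ' => ?_⟩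
  replace hρ' := (isGTModuleStructure_iff ρ').1 hρ'
  let K : LieSubalgebra ℂ (gl n) :=
    { LinearMap.eqLocus (ρ' : gl n →ₗ[ℂ] Module.End ℂ (V L)) (ρ : gl n →ₗ[ℂ] Module.End ℂ (V L)) with
      lie_mem' := fun {x y} (hx : ρ' x = ρ x) (hy : ρ' y = ρ y) => by
        change ρ' ⁅x, y⁆ = ρ ⁅x, y⁆
        rw [LieHom.map_lie, LieHom.map_lie, hx, hy] }
  have htop : K = ⊤ := by
    refine lieSubalgebra_eq_top _ ?_ ?_ ?_ <;> intro k h1 h2 <;>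
      obtain ⟨k, rfl⟩ := Nat.exists_eq_add_of_le' h1
    · exact (hρ'.1 k h2).trans (hρ.1 k h2).symm
    · exact (hρ'.2.1 k h2).trans (hρ.2.1 k h2).symm
    · exact (hρ'.2.2 k h2).trans (hρ.2.2 k h2).symm
  ext1 x
  have : x ∈ K := htop ▸ LieSubalgebra.mem_top x
  exact this

end ModuleStructure

/-! ### Separating tableaux by diagonal operators in a stable subspace. -/

section Submodules

/-- The algebra of endomorphisms that map a submodule into itself. -/
def stableAlgebra {M : Type*} [AddCommGroup M] [Module ℂ M] (P : Submodule ℂ M) :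
    Subalgebra ℂ (Module.End ℂ M) where
  carrier := {a | ∀ w ∈ P, a w ∈ P}
  mul_mem' ha hb w hw := ha _ (hb w hw)
  add_mem' ha hb w hw := P.add_mem (ha w hw) (hb w hw)
  algebraMap_mem' c w hw := by
    rw [Module.algebraMap_end_apply]
    exact P.smul_mem c hw

theorem lie_mem_subalgebra {A : Type*} [Ring A] [Algebra ℂ A] (S : Subalgebra ℂ A) {a b : A}
    (ha : a ∈ S) (hb : b ∈ S) : ⁅a, b⁆ ∈ S := by
  rw [Ring.lie_def]
  exact S.sub_mem (S.mul_mem ha hb) (S.mul_mem hb ha)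

/-- Eigenvector components with distinct eigenvalues of a vector in a stable subspace lie in
the subspace. -/
theorem mem_of_sum_eigenvectors_mem {M ι : Type*} [AddCommGroup M] [Module ℂ M]
    {P : Submodule ℂ M} {a : Module.End ℂ M} (ha : ∀ w ∈ P, a w ∈ P) (μ : ι → ℂ) (s : Finset ι)
    (hμ : Set.InjOn μ s) (v : ι → M) (hv : ∀ i ∈ s, a (v i) = μ i • v i)
    (hsum : ∑ i ∈ s, v i ∈ P) : ∀ i ∈ s, v i ∈ P := by
  classical
  induction s using Finset.induction_on generalizing v with
  | empty => simp
  | insert b s hb ih =>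
    have hs : ∀ i ∈ s, v i ∈ P := by
      intro i hi
      -- Applying `a - μ b` removes the component at `b` and multiplies the others by nonzero
      -- scalars.
      have h1 := ih (hμ.mono (by simp)) (fun i => (μ i - μ b) • v i)
        (fun i hi => by rw [map_smul, hv i (Finset.mem_insert_of_mem hi), smul_comm]) (by
          have h2 := P.sub_mem (ha _ hsum) (P.smul_mem (μ b) hsum)
          rw [map_sum, Finset.smul_sum, ← Finset.sum_sub_distrib, Finset.sum_insert hb,
            hv b (Finset.mem_insert_self b s), sub_self, zero_add] at h2
          convert h2 using 1
          refine Finset.sum_congr rfl fun i hi => ?_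
          rw [hv i (Finset.mem_insert_of_mem hi), sub_smul]) i hi
      have hne : μ i - μ b ≠ 0 := sub_ne_zero.2 fun h => hb <| by
        rwa [← hμ (Finset.mem_insert_of_mem hi) (Finset.mem_insert_self b s) h]
      exact (P.smul_mem_iff hne).1 h1
    intro i hi
    rcases Finset.mem_insert.1 hi with rfl | hi
    · rw [Finset.sum_insert hb] at hsum
      exact (P.add_mem_iff_left (P.sum_mem hs)).1 hsum
    · exact hs i hi

variable {n : ℕ} {L : Tableau n}

/-- Diagonal operators form an algebra isomorphic to the functions on tableaux. -/
noncomputable def diagOpHom (L : Tableau n) :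
    (tableauSet L → ℂ) →ₐ[ℂ] Module.End ℂ (V L) where
  toFun := diagOp
  map_one' := end_ext fun R => by simp
  map_mul' d d' := end_ext fun R => by simp [mul_smul, smul_comm (d R)]
  map_zero' := end_ext fun R => by simp
  map_add' d d' := end_ext fun R => by simp [add_smul]
  commutes' c := end_ext fun R => by simp [Module.algebraMap_end_apply]

/-- The sum of the entries of row `k`. -/
noncomputable def rowSum (k : ℕ) (R : tableauSet L) : ℂ := ∑ i ∈ Finset.Icc 1 k, R.1.entry k i

/-- The sum of the squares of the entries of row `k`. -/
noncomputable def rowSumSq (k : ℕ) (R : tableauSet L) : ℂ :=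
  ∑ i ∈ Finset.Icc 1 k, R.1.entry k i ^ 2

theorem rowSumSq_shift (R : tableauSet L) {k i : ℕ} (hk : k < n) (hi : i ∈ Finset.Icc 1 k)
    (ε : ℤ) : rowSumSq k (shift R k i hk ε) - rowSumSq k R = 2 * ε * R.1.entry k i + ε ^ 2 := by
  rw [rowSumSq, rowSumSq, ← Finset.add_sum_erase _ _ hi, ← Finset.add_sum_erase _ _ hi,
    entry_shift_self R hk ε hi, Finset.sum_congr rfl fun j hj => by
      rw [entry_shift_col_ne R hk ε (Finset.ne_of_mem_erase hj)]]
  ring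

/-- Weighting the raising operator by the moved entry produces the next moment of the residues,
where the square sum of row `k + 2` appears. -/
theorem rowOp_id_lie_gtLower (hL : IsGeneric L) {k : ℕ} (hk : k + 1 < n) :
    ⁅rowOp (L := L) (k + 1) hk 1 (fun i R => R.1.entry (k + 1) i *
        rowCoeff (k + 1) (k + 2) (Finset.Icc 1 (k + 2)) i R), gtLower L k⁆ =
      diagOp fun R => -(((2 * rowSum (k + 1) R - rowSum (k + 2) R - rowSum k R - 1) ^ 2 +
        (2 * rowSumSq (k + 1) R - rowSumSq (k + 2) R - rowSumSq k R - 2 * rowSum (k + 1) R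
          + 2 * rowSum k R + 1)) / 2) := by
  have h := rowOp_lie_same_row hL (m := k + 2) (m' := k) (Finset.Icc 1 (k + 2)) (Finset.Icc 1 k) hk
    (by omega) (by omega) id
  simp only [id] at h
  rw [gtLower_eq hk, h]
  refine end_ext fun R => ?_
  rw [diagOp_basisVec,
    sum_residues_id (Finset.Icc 1 (k + 1)) (R.1.entry (k + 1)) (Finset.Icc 1 (k + 2))
      (Finset.Icc 1 k) (R.1.entry (k + 2)) (R.1.entry k)
      (fun i hi j hj hij m => entry_sub_ne_intCast hL R hk hi hj hij m)
      (by simp) (by simp) (by simp), diagOp_basisVec]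
  rfl

/-- A subalgebra of `End V(T(L))` that contains the operators of the Gelfand–Tsetlin formulas. -/
structure ContainsGTOperators (S : Subalgebra ℂ (Module.End ℂ (V L))) : Prop where
  raise : ∀ k, k + 1 < n → gtRaise L k ∈ S
  lower : ∀ k, k + 1 < n → gtLower L k ∈ S
  diag : ∀ k, k < n → gtDiag L k ∈ S

namespace ContainsGTOperators

variable {S : Subalgebra ℂ (Module.End ℂ (V L))}

theorem rowSum_mem (hS : ContainsGTOperators S) (k : ℕ) (hk : k ≤ n) :
    rowSum k ∈ S.comap (diagOpHom L) := by
  induction k with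
  | zero =>
    have : (rowSum 0 : tableauSet L → ℂ) = 0 := by ext R; simp [rowSum]
    rw [this]
    exact zero_mem _
  | succ k ih =>
    have h1 : (fun R : tableauSet L => diagCoeff R.1 (k + 1)) ∈ S.comap (diagOpHom L) :=
      hS.diag k hk
    have h2 : (rowSum (k + 1) : tableauSet L → ℂ) =
        (fun R : tableauSet L => diagCoeff R.1 (k + 1)) - algebraMap ℂ _ (k : ℂ) + rowSum k := by
      ext R
      simp [rowSum, diagCoeff]
      ring
    rw [h2]
    exact add_mem (sub_mem h1 (Subalgebra.algebraMap_mem _ _)) (ih (by omega))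

/-- Induction upwards through the rows. Commuting the square sum of row `k + 1` with the raising
operator weights each term by the moved entry; the bracket of the result with the lowering operator
is diagonal and involves the square sum of row `k + 2` linearly. No central elements or higher
Casimir operators are needed. -/
theorem rowSumSq_mem (hL : IsGeneric L) (hS : ContainsGTOperators S) (k : ℕ) (hk : k ≤ n) :
    rowSumSq k ∈ S.comap (diagOpHom L) := by
  induction k using Nat.strong_induction_on with
  | _ k ih =>
  match k, ih, hk with
  | 0, _, _ =>
    have : (rowSumSq 0 : tableauSet L → ℂ) = 0 := by ext R; simp [rowSumSq]
    rw [this]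
    exact zero_mem _
  | 1, _, hk =>
    have : (rowSumSq 1 : tableauSet L → ℂ) = rowSum 1 ^ 2 := by ext R; simp [rowSumSq, rowSum]
    rw [this]
    exact pow_mem (hS.rowSum_mem 1 hk) 2
  | k + 2, ih, hk =>
    have hk1 : k + 1 < n := hk
    have h0 := ih k (by omega) (by omega)
    have h1 := ih (k + 1) (by omega) (by omega)
    have hraise := hS.raise k hk
    have h2 : ⁅diagOp (rowSumSq (L := L) (k + 1)), gtRaise L k⁆ ∈ S := lie_mem_subalgebra S h1 hraise
    -- The commutator multiplies the `i`-th term by `2 r + 1`, and `gtRaise` carries a minus sign: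
    -- hence the subtraction and the factor -1/2.
    have h3 : rowOp (L := L) (k + 1) hk1 1 (fun i R => R.1.entry (k + 1) i *
        rowCoeff (k + 1) (k + 2) (Finset.Icc 1 (k + 2)) i R) =
        (-1 / 2 : ℂ) • (⁅diagOp (rowSumSq (L := L) (k + 1)), gtRaise L k⁆ - gtRaise L k) := by
      rw [gtRaise_eq hk1, lie_smul, diagOp_lie_rowOp, ← smul_sub, smul_smul]
      refine end_ext fun R => ?_
      rw [LinearMap.smul_apply, LinearMap.sub_apply, rowOp_basisVec, rowOp_basisVec,
        rowOp_basisVec, ← Finset.sum_sub_distrib, Finset.smul_sum]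
      refine Finset.sum_congr rfl fun i hi => ?_
      rw [rowSumSq_shift R hk1 hi, ← sub_smul, smul_smul]
      congr 1
      push_cast
      ring
    have h4 := lie_mem_subalgebra S (h3 ▸ S.smul_mem (sub_mem h2 hraise) (-1 / 2 : ℂ))
      (hS.lower k hk)
    rw [rowOp_id_lie_gtLower hL hk1] at h4
    set η : tableauSet L → ℂ := fun R =>
      -(((2 * rowSum (k + 1) R - rowSum (k + 2) R - rowSum k R - 1) ^ 2 +
        (2 * rowSumSq (k + 1) R - rowSumSq (k + 2) R - rowSumSq k R - 2 * rowSum (k + 1) R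
          + 2 * rowSum k R + 1)) / 2) with hη
    have h5 : η ∈ S.comap (diagOpHom L) := h4
    have s0 := hS.rowSum_mem k (by omega)
    have s1 := hS.rowSum_mem (k + 1) (by omega)
    have s2 := hS.rowSum_mem (k + 2) hk
    have h6 : (rowSumSq (k + 2) : tableauSet L → ℂ) =
        (2 : ℂ) • η + ((2 : ℂ) • rowSum (k + 1) - rowSum (k + 2) - rowSum k - 1) ^ 2 +
          (2 : ℂ) • rowSumSq (k + 1) - rowSumSq k - (2 : ℂ) • rowSum (k + 1)
          + (2 : ℂ) • rowSum k + 1 := by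
      ext R
      simp only [hη, Pi.add_apply, Pi.sub_apply, Pi.smul_apply, Pi.pow_apply, Pi.one_apply,
        smul_eq_mul]
      ring
    rw [h6]
    exact add_mem (add_mem (sub_mem (sub_mem (add_mem (add_mem (Subalgebra.smul_mem _ h5 _)
      (pow_mem (sub_mem (sub_mem (sub_mem (Subalgebra.smul_mem _ s1 _) s2) s0) (one_mem _)) 2))
      (Subalgebra.smul_mem _ h1 _)) h0) (Subalgebra.smul_mem _ s1 _))
      (Subalgebra.smul_mem _ s0 _)) (one_mem _)

end ContainsGTOperators

/-- Two of the values differ by `2 ε (r_{ki} - r_{kj})`, nonzero by genericity. -/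
theorem injOn_rowSumSq_shift (hL : IsGeneric L) (R : tableauSet L) {k : ℕ} (hk : k < n) {ε : ℤ}
    (hε : ε ≠ 0) :
    Set.InjOn (fun i => rowSumSq k (shift R k i hk ε)) (Finset.Icc 1 k : Finset ℕ) := by
  intro i hi j hj hij
  by_contra hne
  have h1 := rowSumSq_shift R hk hi ε
  have h2 := rowSumSq_shift R hk hj ε
  have hε' : (ε : ℂ) ≠ 0 := Int.cast_ne_zero.2 hε
  refine entry_sub_ne_intCast hL R hk hi hj hne 0 ?_
  simp only at hij
  have h3 : (2 * ε : ℂ) * (R.1.entry k i - R.1.entry k j) = 0 := by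
    linear_combination hij - h1 + h2
  simpa [hε'] using h3

theorem basisVec_shift_mem_of_rowOp_mem (hL : IsGeneric L) {P : Submodule ℂ (V L)}
    (hP : ContainsGTOperators (stableAlgebra P)) (R : tableauSet L) {k : ℕ} (hk : k < n) {ε : ℤ}
    (hε : ε ≠ 0) (c : ℕ → tableauSet L → ℂ) (h : rowOp k hk ε c (basisVec R) ∈ P) {i : ℕ}
    (hi : i ∈ Finset.Icc 1 k) (hc : c i R ≠ 0) : basisVec (shift R k i hk ε) ∈ P := by
  rw [rowOp_basisVec] at h
  have := mem_of_sum_eigenvectors_mem (a := diagOp (rowSumSq k)) (hP.rowSumSq_mem hL k hk.le)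
    (fun i => rowSumSq k (shift R k i hk ε)) _ (injOn_rowSumSq_shift hL R hk hε) _
    (fun i _ => by rw [map_smul, diagOp_basisVec, smul_comm]) h i hi
  exact (P.smul_mem_iff hc).1 this

theorem basisVec_raise_mem (hL : IsGeneric L) {P : Submodule ℂ (V L)}
    (hP : ContainsGTOperators (stableAlgebra P)) {R : tableauSet L} (hR : basisVec R ∈ P) {k : ℕ}
    (hk : k < n) {i : ℕ} (hi : i ∈ Finset.Icc 1 k) (hc : raiseCoeff R.1 k i ≠ 0) :
    basisVec (shift R k i hk 1) ∈ P := by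
  obtain ⟨k, rfl⟩ := Nat.exists_eq_add_of_le' (show 1 ≤ k by rw [Finset.mem_Icc] at hi; omega)
  have := hP.raise k hk _ hR
  rw [gtRaise, dif_pos hk] at this
  exact basisVec_shift_mem_of_rowOp_mem hL hP R hk one_ne_zero _ this hi hc

theorem basisVec_lower_mem (hL : IsGeneric L) {P : Submodule ℂ (V L)}
    (hP : ContainsGTOperators (stableAlgebra P)) {R : tableauSet L} (hR : basisVec R ∈ P) {k : ℕ}
    (hk : k < n) {i : ℕ} (hi : i ∈ Finset.Icc 1 k) (hc : lowerCoeff R.1 k i ≠ 0) :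
    basisVec (shift R k i hk (-1)) ∈ P := by
  obtain ⟨k, rfl⟩ := Nat.exists_eq_add_of_le' (show 1 ≤ k by rw [Finset.mem_Icc] at hi; omega)
  have := hP.lower k hk _ hR
  rw [gtLower, dif_pos hk] at this
  exact basisVec_shift_mem_of_rowOp_mem hL hP R hk (by decide) _ this hi hc

/-! ### Vanishing of coefficients and preservation of Ω⁺. -/

theorem denominator_ne_zero (hL : IsGeneric L) (R : tableauSet L) {k i : ℕ} (hk : k < n)
    (hi : i ∈ Finset.Icc 1 k) :
    ∏ j ∈ (Finset.Icc 1 k).erase i, (R.1.entry k i - R.1.entry k j) ≠ 0 := by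
  refine Finset.prod_ne_zero_iff.2 fun j hj => ?_
  have := entry_sub_ne_intCast hL R hk hi (Finset.mem_of_mem_erase hj)
    (Finset.ne_of_mem_erase hj).symm 0
  simpa using this

theorem raiseCoeff_ne_zero (hL : IsGeneric L) (R : tableauSet L) {k i : ℕ} (hk : k < n)
    (hi : i ∈ Finset.Icc 1 k)
    (h : ∀ j ∈ Finset.Icc 1 (k + 1), R.1.entry k i ≠ R.1.entry (k + 1) j) :
    raiseCoeff R.1 k i ≠ 0 :=
  neg_ne_zero.2 (div_ne_zero (Finset.prod_ne_zero_iff.2 fun j hj => sub_ne_zero.2 (h j hj))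
    (denominator_ne_zero hL R hk hi))

theorem lowerCoeff_ne_zero (hL : IsGeneric L) (R : tableauSet L) {k i : ℕ} (hk : k < n)
    (hi : i ∈ Finset.Icc 1 k)
    (h : ∀ j ∈ Finset.Icc 1 (k - 1), R.1.entry k i ≠ R.1.entry (k - 1) j) :
    lowerCoeff R.1 k i ≠ 0 :=
  div_ne_zero (Finset.prod_ne_zero_iff.2 fun j hj => sub_ne_zero.2 (h j hj))
    (denominator_ne_zero hL R hk hi)

theorem entry_ne_of_raiseCoeff_ne_zero (R : Tableau n) {k i j : ℕ} (h : raiseCoeff R k i ≠ 0)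
    (hj : j ∈ Finset.Icc 1 (k + 1)) : R.entry k i ≠ R.entry (k + 1) j := by
  refine fun heq => h ?_
  rw [raiseCoeff, Finset.prod_eq_zero hj (sub_eq_zero.2 heq)]
  simp

theorem entry_ne_of_lowerCoeff_ne_zero (R : Tableau n) {k i j : ℕ} (h : lowerCoeff R k i ≠ 0)
    (hj : j ∈ Finset.Icc 1 (k - 1)) : R.entry k i ≠ R.entry (k - 1) j := by
  refine fun heq => h ?_
  rw [lowerCoeff, Finset.prod_eq_zero hj (sub_eq_zero.2 heq)]
  simp

/-- Raising (k, i) decreases only the differences `r_{k+1,s} - r_{ki}`. One of them can leave ℤ≥0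
only from 0, and then the numerator vanishes. -/
theorem omegaPlus_subset_raise (R : tableauSet L) {k i : ℕ} (hk : k < n)
    (hi : i ∈ Finset.Icc 1 k) (hc : raiseCoeff R.1 k i ≠ 0) :
    OmegaPlus R.1 ⊆ OmegaPlus (shift R k i hk 1).1 := by
  rintro ⟨p, s, u⟩ ⟨hp, hs, hu, m, hm⟩
  refine ⟨hp, hs, hu, ?_⟩
  simp only at hp hs hu hm ⊢
  by_cases h1 : (p, s) = (k, i)
  · obtain ⟨rfl, rfl⟩ := Prod.mk.inj h1
    rw [entry_shift_self R hk 1 hi, entry_shift_row_ne R hk 1 _ (by omega)]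
    exact ⟨m + 1, by push_cast; linear_combination hm⟩
  rw [entry_shift_of_ne R hk 1 h1]
  by_cases h2 : (p - 1, u) = (k, i)
  · obtain ⟨rfl, rfl⟩ := Prod.mk.inj h2
    obtain ⟨p, rfl⟩ := Nat.exists_eq_add_of_le' (show 1 ≤ p by omega)
    rw [entry_shift_self R hk 1 hi]
    rcases m with _ | m
    · refine absurd ?_ (entry_ne_of_raiseCoeff_ne_zero R.1 hc (Finset.mem_Icc.2 hs))
      exact (sub_eq_zero.1 (by simpa using hm)).symm
    · exact ⟨m, by push_cast at hm ⊢; linear_combination hm⟩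
  · rw [entry_shift_of_ne R hk 1 h2]
    exact ⟨m, hm⟩

theorem omegaPlus_subset_lower (R : tableauSet L) {k i : ℕ} (hk : k < n)
    (hi : i ∈ Finset.Icc 1 k) (hc : lowerCoeff R.1 k i ≠ 0) :
    OmegaPlus R.1 ⊆ OmegaPlus (shift R k i hk (-1)).1 := by
  rintro ⟨p, s, u⟩ ⟨hp, hs, hu, m, hm⟩
  refine ⟨hp, hs, hu, ?_⟩
  simp only at hp hs hu hm ⊢
  by_cases h1 : (p, s) = (k, i)
  · obtain ⟨rfl, rfl⟩ := Prod.mk.inj h1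
    rw [entry_shift_self R hk (-1) hi, entry_shift_row_ne R hk (-1) _ (by omega)]
    rcases m with _ | m
    · refine absurd ?_ (entry_ne_of_lowerCoeff_ne_zero R.1 hc (Finset.mem_Icc.2 hu))
      exact sub_eq_zero.1 (by simpa using hm)
    · exact ⟨m, by push_cast at hm ⊢; linear_combination hm⟩
  rw [entry_shift_of_ne R hk (-1) h1]
  by_cases h2 : (p - 1, u) = (k, i)
  · obtain ⟨rfl, rfl⟩ := Prod.mk.inj h2
    rw [entry_shift_self R hk (-1) hi]
    exact ⟨m + 1, by push_cast; linear_combination hm⟩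
  · rw [entry_shift_of_ne R hk (-1) h2]
    exact ⟨m, hm⟩

end Submodules

/-! ### Paths between tableaux and the submodule generated by one of them. -/

section Generation

variable {n : ℕ} {L : Tableau n}

/-- The entry of an integral array, zero for indices outside of the triangle. -/
def arrayEntry (z : Pos n → ℤ) (i j : ℕ) : ℤ :=
  if h : 1 ≤ j ∧ j ≤ i ∧ i ≤ n then z ⟨(i, j), h⟩ else 0

theorem entry_translate (R : Tableau n) (z : Pos n → ℤ) (i j : ℕ) :
    (R.translate z).entry i j = R.entry i j + arrayEntry z i j := by
  simp only [Tableau.entry, arrayEntry, Tableau.translate]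
  split_ifs <;> simp

theorem exists_translate_eq (X Q : tableauSet L) :
    ∃ z : Pos n → ℤ, (∀ p, p.1.1 = n → z p = 0) ∧ Q.1 = X.1.translate z := by
  obtain ⟨X, x, hx, rfl⟩ := X
  obtain ⟨Q, q, hq, rfl⟩ := Q
  refine ⟨q - x, fun p hp => by simp [hx p hp, hq p hp], ?_⟩
  funext p
  simp [Tableau.translate]

instance : Finite (Pos n) :=
  Finite.of_injective (β := Fin (n + 1) × Fin (n + 1))
    (fun p => (⟨p.1.1, by omega⟩, ⟨p.1.2, by omega⟩)) fun p q h => by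
      simp only [Prod.mk.injEq, Fin.mk.injEq] at h
      exact Subtype.ext (Prod.ext h.1 h.2)

theorem exists_maximal_entry (w : Pos n → Prop) (hw : ∃ p, w p) (f : Pos n → ℝ) :
    ∃ p, w p ∧ ∀ q, w q → f q ≤ f p := by
  obtain ⟨p, hp, hmax⟩ := Set.exists_max_image {p | w p} f (Set.toFinite _) hw
  exact ⟨p, hp, hmax⟩

/-- A step of a path from `X` to `Q` that raises an entry. -/
theorem exists_raise_step (hL : IsGeneric L) (X Q : tableauSet L) (z : Pos n → ℤ)
    (hz : ∀ p, p.1.1 = n → z p = 0) (hQ : Q.1 = X.1.translate z)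
    (hΩ : OmegaPlus X.1 ⊆ OmegaPlus Q.1) (hpos : ∃ p, 0 < z p) :
    ∃ (p : Pos n) (hk : p.1.1 < n), 0 < z p ∧ raiseCoeff X.1 p.1.1 p.1.2 ≠ 0 ∧
      OmegaPlus (shift X p.1.1 p.1.2 hk 1).1 ⊆ OmegaPlus Q.1 := by
  -- The slope 1/2 lies strictly between 0 and 1: among positions with `z > 0`, the chosen one then
  -- beats both an equal entry one row up and an entry larger by 1 one row down, which are the two
  -- obstructions to raising it.
  obtain ⟨⟨⟨k, i⟩, hki⟩, hp, hmax⟩ := exists_maximal_entry (fun p => 0 < z p) hpos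
    (fun p => (X.1.entry p.1.1 p.1.2).re + (p.1.1 : ℝ) / 2)
  simp only at hki hp hmax
  have hk : k < n := lt_of_le_of_ne hki.2.2 fun h => by
    rw [hz _ h] at hp; exact lt_irrefl _ hp
  have hi : i ∈ Finset.Icc 1 k := Finset.mem_Icc.2 ⟨hki.1, hki.2.1⟩
  have hzki : arrayEntry z k i = z ⟨(k, i), hki⟩ := dif_pos hki
  have hmax' : ∀ k' i', 0 < arrayEntry z k' i' →
      (X.1.entry k' i').re + (k' : ℝ) / 2 ≤ (X.1.entry k i).re + (k : ℝ) / 2 := by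
    intro k' i' h
    rw [arrayEntry] at h
    split_ifs at h with h'
    · exact hmax ⟨(k', i'), h'⟩ h
    · exact absurd h (lt_irrefl 0)
  have hent : ∀ a b, Q.1.entry a b = X.1.entry a b + arrayEntry z a b := fun a b => by
    rw [hQ, entry_translate]
  -- If `x_{ki} = x_{k+1,j}`, the relation persists in `Q`, so `z_{k+1,j} ≥ z_{ki} > 0` at a
  -- position of larger weight.
  refine ⟨⟨(k, i), hki⟩, hk, hp, raiseCoeff_ne_zero hL X hk hi fun j hj heq => ?_, ?_⟩
  · rw [Finset.mem_Icc] at hj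
    obtain ⟨-, -, -, m, hm⟩ := hΩ (show (k + 1, j, i) ∈ OmegaPlus X.1 from
      ⟨⟨by simp only; omega, hk⟩, hj, ⟨hki.1, hki.2.1⟩, 0, by simp [heq]⟩)
    simp only [Nat.add_sub_cancel, hent, heq] at hm
    have hm' : arrayEntry z (k + 1) j - arrayEntry z k i = (m : ℤ) := by
      have : ((arrayEntry z (k + 1) j - arrayEntry z k i : ℤ) : ℂ) = ((m : ℤ) : ℂ) := by
        push_cast; linear_combination hm
      exact_mod_cast this
    have := hmax' (k + 1) j (by omega)
    rw [heq] at this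
    push_cast at this
    linarith
  · rintro ⟨p, s, u⟩ ⟨hp', hs, hu, m, hm⟩
    simp only at hp' hs hu hm
    by_cases h1 : (p, s) = (k, i)
    · obtain ⟨rfl, rfl⟩ := Prod.mk.inj h1
      rw [entry_shift_self X hk 1 hi, entry_shift_row_ne X hk 1 _ (by omega)] at hm
      rcases m with _ | m
      -- The only relation created by the step is `x_{ki} + 1 = x_{k-1,u}`. Maximality gives
      -- `z_{k-1,u} ≤ 0`, and with `z_{ki} ≥ 1` the relation holds in `Q`.
      · have hle : arrayEntry z (p - 1) u ≤ 0 := by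
          by_contra! hlt
          have h2 := hmax' _ _ hlt
          have h3 : X.1.entry (p - 1) u = X.1.entry p s + 1 := by
            push_cast at hm; linear_combination -hm
          rw [h3, Complex.add_re, Complex.one_re, Nat.cast_sub (by omega)] at h2
          push_cast at h2
          linarith
        refine ⟨hp', hs, hu, (arrayEntry z p s - arrayEntry z (p - 1) u - 1).toNat, ?_⟩
        have h4 : (((arrayEntry z p s - arrayEntry z (p - 1) u - 1).toNat : ℤ) : ℂ) =
          ((arrayEntry z p s - arrayEntry z (p - 1) u - 1 : ℤ) : ℂ) := by
          rw [Int.toNat_of_nonneg (by omega)]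
        rw [Int.cast_natCast] at h4
        rw [h4, hent, hent]
        push_cast at hm ⊢
        linear_combination hm
      · exact hΩ ⟨hp', hs, hu, m, by push_cast at hm ⊢; linear_combination hm⟩
    rw [entry_shift_of_ne X hk 1 h1] at hm
    by_cases h2 : (p - 1, u) = (k, i)
    · obtain ⟨rfl, rfl⟩ := Prod.mk.inj h2
      rw [entry_shift_self X hk 1 hi] at hm
      exact hΩ ⟨hp', hs, hu, m + 1, by push_cast at hm ⊢; linear_combination hm⟩
    · rw [entry_shift_of_ne X hk 1 h2] at hm
      exact hΩ ⟨hp', hs, hu, m, hm⟩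

/-- A step of a path from `X` to `Q` that lowers an entry. -/
theorem exists_lower_step (hL : IsGeneric L) (X Q : tableauSet L) (z : Pos n → ℤ)
    (hz : ∀ p, p.1.1 = n → z p = 0) (hQ : Q.1 = X.1.translate z)
    (hΩ : OmegaPlus X.1 ⊆ OmegaPlus Q.1) (hneg : ∃ p, z p < 0) :
    ∃ (p : Pos n) (hk : p.1.1 < n), z p < 0 ∧ lowerCoeff X.1 p.1.1 p.1.2 ≠ 0 ∧
      OmegaPlus (shift X p.1.1 p.1.2 hk (-1)).1 ⊆ OmegaPlus Q.1 := by
  -- The mirror image: the same weight is minimised over the positions with `z < 0`.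
  obtain ⟨⟨⟨k, i⟩, hki⟩, hp, hmax⟩ := exists_maximal_entry (fun p => z p < 0) hneg
    (fun p => -((X.1.entry p.1.1 p.1.2).re + (p.1.1 : ℝ) / 2))
  simp only at hki hp hmax
  have hk : k < n := lt_of_le_of_ne hki.2.2 fun h => by
    rw [hz _ h] at hp; exact lt_irrefl _ hp
  have hi : i ∈ Finset.Icc 1 k := Finset.mem_Icc.2 ⟨hki.1, hki.2.1⟩
  have hzki : arrayEntry z k i = z ⟨(k, i), hki⟩ := dif_pos hki
  have hmin : ∀ k' i', arrayEntry z k' i' < 0 →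
      (X.1.entry k i).re + (k : ℝ) / 2 ≤ (X.1.entry k' i').re + (k' : ℝ) / 2 := by
    intro k' i' h
    rw [arrayEntry] at h
    split_ifs at h with h'
    · exact neg_le_neg_iff.1 (hmax ⟨(k', i'), h'⟩ h)
    · exact absurd h (lt_irrefl 0)
  have hent : ∀ a b, Q.1.entry a b = X.1.entry a b + arrayEntry z a b := fun a b => by
    rw [hQ, entry_translate]
  refine ⟨⟨(k, i), hki⟩, hk, hp, lowerCoeff_ne_zero hL X hk hi fun j hj heq => ?_, ?_⟩
  · replace hj : 1 ≤ j ∧ j ≤ k - 1 := Finset.mem_Icc.1 hj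
    obtain ⟨-, -, -, m, hm⟩ := hΩ (show (k, i, j) ∈ OmegaPlus X.1 from
      ⟨⟨by change 1 < k; omega, hk.le⟩, ⟨hki.1, hki.2.1⟩, hj, 0, by simp [heq]⟩)
    simp only [hent, heq] at hm
    have hm' : arrayEntry z k i - arrayEntry z (k - 1) j = (m : ℤ) := by
      have : ((arrayEntry z k i - arrayEntry z (k - 1) j : ℤ) : ℂ) = ((m : ℤ) : ℂ) := by
        push_cast; linear_combination hm
      exact_mod_cast this
    have := hmin (k - 1) j (by omega)
    rw [heq, Nat.cast_sub (by omega)] at this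
    push_cast at this
    linarith
  · rintro ⟨p, s, u⟩ ⟨hp', hs, hu, m, hm⟩
    simp only at hp' hs hu hm
    by_cases h1 : (p, s) = (k, i)
    · obtain ⟨rfl, rfl⟩ := Prod.mk.inj h1
      rw [entry_shift_self X hk (-1) hi, entry_shift_row_ne X hk (-1) _ (by omega)] at hm
      exact hΩ ⟨hp', hs, hu, m + 1, by push_cast at hm ⊢; linear_combination hm⟩
    rw [entry_shift_of_ne X hk (-1) h1] at hm
    by_cases h2 : (p - 1, u) = (k, i)
    · obtain ⟨rfl, rfl⟩ := Prod.mk.inj h2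
      rw [entry_shift_self X hk (-1) hi] at hm
      rcases m with _ | m
      · have hle : 0 ≤ arrayEntry z p s := by
          by_contra! hlt
          have h2 := hmin _ _ hlt
          have h3 : X.1.entry p s = X.1.entry (p - 1) u - 1 := by
            push_cast at hm; linear_combination hm
          rw [h3, Complex.sub_re, Complex.one_re, Nat.cast_sub (by omega)] at h2
          push_cast at h2
          linarith
        refine ⟨hp', hs, hu, (arrayEntry z p s - arrayEntry z (p - 1) u - 1).toNat, ?_⟩
        have h4 : (((arrayEntry z p s - arrayEntry z (p - 1) u - 1).toNat : ℤ) : ℂ) =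
          ((arrayEntry z p s - arrayEntry z (p - 1) u - 1 : ℤ) : ℂ) := by
          rw [Int.toNat_of_nonneg (by omega)]
        rw [Int.cast_natCast] at h4
        rw [h4, hent, hent]
        push_cast at hm ⊢
        linear_combination hm
      · exact hΩ ⟨hp', hs, hu, m, by push_cast at hm ⊢; linear_combination hm⟩
    · rw [entry_shift_of_ne X hk (-1) h2] at hm
      exact hΩ ⟨hp', hs, hu, m, hm⟩

/-- Induction on the ℓ¹ distance from `X` to `Q`, the target `Q` being fixed; each step shortens the
distance and keeps the inclusion of Ω⁺. -/
theorem basisVec_mem_of_omegaPlus_subset (hL : IsGeneric L) {P : Submodule ℂ (V L)}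
    (hP : ContainsGTOperators (stableAlgebra P)) {X Q : tableauSet L} (hX : basisVec X ∈ P)
    (hΩ : OmegaPlus X.1 ⊆ OmegaPlus Q.1) : basisVec Q ∈ P := by
  classical
  have := Fintype.ofFinite (Pos n)
  obtain ⟨z, hz, hQ⟩ := exists_translate_eq X Q
  induction hm : ∑ p, (z p).natAbs using Nat.strong_induction_on generalizing X z with
  | _ m ih =>
  have step : ∀ (p : Pos n) (hk : p.1.1 < n) (ε : ℤ), (z p - ε).natAbs < (z p).natAbs →
      basisVec (shift X p.1.1 p.1.2 hk ε) ∈ P →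
      OmegaPlus (shift X p.1.1 p.1.2 hk ε).1 ⊆ OmegaPlus Q.1 → basisVec Q ∈ P := by
    intro p hk ε hlt hmem hsub
    have hδ : delta n p.1.1 p.1.2 p = 1 := by simp [delta]
    have hδ' : ∀ q, q ≠ p → delta n p.1.1 p.1.2 q = 0 := fun q hq => by
      rw [delta, if_neg fun h => hq (Subtype.ext h)]
    refine ih (∑ q, ((z - ε • delta n p.1.1 p.1.2) q).natAbs) ?_ hmem hsub _ ?_ ?_ rfl
    · rw [← hm]
      refine Finset.sum_lt_sum (fun q _ => ?_) ⟨p, Finset.mem_univ p, by simpa [hδ] using hlt⟩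
      by_cases hq : q = p
      · subst hq; simpa [hδ] using hlt.le
      · simp [hδ' q hq]
    · intro q hq
      have : q ≠ p := by rintro rfl; omega
      simp [hz q hq, hδ' q this]
    · rw [hQ]
      funext q
      simp [shift, Tableau.translate]
  by_cases hpos : ∃ p, 0 < z p
  · obtain ⟨p, hk, hp, hc, hsub⟩ := exists_raise_step hL X Q z hz hQ hΩ hpos
    exact step p hk 1 (by omega)
      (basisVec_raise_mem hL hP hX hk (Finset.mem_Icc.2 ⟨p.2.1, p.2.2.1⟩) hc) hsub
  by_cases hneg : ∃ p, z p < 0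
  · obtain ⟨p, hk, hp, hc, hsub⟩ := exists_lower_step hL X Q z hz hQ hΩ hneg
    exact step p hk (-1) (by omega)
      (basisVec_lower_mem hL hP hX hk (Finset.mem_Icc.2 ⟨p.2.1, p.2.2.1⟩) hc) hsub
  push Not at hpos hneg
  have hz0 : z = 0 := funext fun p => le_antisymm (hpos p) (hneg p)
  have : Q = X := Subtype.ext <| by rw [hQ, hz0]; funext p; simp [Tableau.translate]
  rwa [this]

/-! ### W(T(R)) as the generated submodule, with its basis and restricted action. -/

theorem mem_N_iff {R Q : tableauSet L} : Q ∈ N R ↔ OmegaPlus R.1 ⊆ OmegaPlus Q.1 := Iff.rfl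

theorem basisVec_mem_W {R Q : tableauSet L} (h : Q ∈ N R) : basisVec Q ∈ W R :=
  Submodule.subset_span ⟨Q, h, rfl⟩

theorem raise_eq_zero_or_mem_N {R Q : tableauSet L} (hQ : Q ∈ N R) {k i : ℕ} (hk : k < n)
    (hi : i ∈ Finset.Icc 1 k) : raiseCoeff Q.1 k i = 0 ∨ shift Q k i hk 1 ∈ N R :=
  or_iff_not_imp_left.2 fun h => (mem_N_iff.1 hQ).trans (omegaPlus_subset_raise Q hk hi h)

theorem lower_eq_zero_or_mem_N {R Q : tableauSet L} (hQ : Q ∈ N R) {k i : ℕ} (hk : k < n)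
    (hi : i ∈ Finset.Icc 1 k) : lowerCoeff Q.1 k i = 0 ∨ shift Q k i hk (-1) ∈ N R :=
  or_iff_not_imp_left.2 fun h => (mem_N_iff.1 hQ).trans (omegaPlus_subset_lower Q hk hi h)

theorem containsGTOperators_W (R : tableauSet L) :
    ContainsGTOperators (stableAlgebra (W R)) := by
  have key : ∀ a : Module.End ℂ (V L), (∀ Q ∈ N R, a (basisVec Q) ∈ W R) →
      a ∈ stableAlgebra (W R) := by
    intro a ha
    change W R ≤ (W R).comap a
    refine Submodule.span_le.2 ?_
    rintro _ ⟨Q, hQ, rfl⟩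
    exact ha Q hQ
  refine ⟨fun k hk => key _ fun Q hQ => ?_, fun k hk => key _ fun Q hQ => ?_,
    fun k hk => key _ fun Q hQ => ?_⟩
  · rw [gtRaise, dif_pos hk, rowOp_basisVec]
    refine Submodule.sum_mem _ fun i hi => ?_
    rcases raise_eq_zero_or_mem_N hQ hk hi with h | h
    · rw [h, zero_smul]; exact zero_mem _
    · exact Submodule.smul_mem _ _ (basisVec_mem_W h)
  · rw [gtLower, dif_pos hk, rowOp_basisVec]
    refine Submodule.sum_mem _ fun i hi => ?_
    rcases lower_eq_zero_or_mem_N hQ hk hi with h | h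
    · rw [h, zero_smul]; exact zero_mem _
    · exact Submodule.smul_mem _ _ (basisVec_mem_W h)
  · rw [gtDiag, diagOp_basisVec]
    exact Submodule.smul_mem _ _ (basisVec_mem_W hQ)

theorem stable_iff_containsGTOperators {ρ : gl n →ₗ⁅ℂ⁆ Module.End ℂ (V L)}
    (hρ : IsGTModuleStructure L ρ) (P : Submodule ℂ (V L)) :
    (∀ x, ∀ w ∈ P, ρ x w ∈ P) ↔ ContainsGTOperators (stableAlgebra P) := by
  obtain ⟨hr, hl, hd⟩ := (isGTModuleStructure_iff ρ).1 hρ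
  constructor
  · intro h
    exact ⟨fun k hk => hr k hk ▸ h _, fun k hk => hl k hk ▸ h _, fun k hk => hd k hk ▸ h _⟩
  · intro h
    let K : LieSubalgebra ℂ (gl n) :=
      { (Subalgebra.toSubmodule (stableAlgebra P)).comap
          (ρ : gl n →ₗ[ℂ] Module.End ℂ (V L)) with
        lie_mem' := fun {x y} (hx : ρ x ∈ stableAlgebra P) (hy : ρ y ∈ stableAlgebra P) => by
          change ρ ⁅x, y⁆ ∈ stableAlgebra P
          rw [LieHom.map_lie]
          exact lie_mem_subalgebra _ hx hy }
    have hmem : ∀ x, ρ x ∈ stableAlgebra P → x ∈ K := fun _ hx => hx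
    have htop : K = ⊤ := by
      refine lieSubalgebra_eq_top _ ?_ ?_ ?_ <;> intro k h1 h2 <;>
        obtain ⟨k, rfl⟩ := Nat.exists_eq_add_of_le' h1
      · exact hmem _ (hr k h2 ▸ h.raise k h2)
      · exact hmem _ (hl k h2 ▸ h.lower k h2)
      · exact hmem _ (hd k h2 ▸ h.diag k h2)
    intro x
    have : x ∈ K := htop ▸ LieSubalgebra.mem_top x
    exact this

theorem generatedSubmodule_eq_W (hL : IsGeneric L) {ρ : gl n →ₗ⁅ℂ⁆ Module.End ℂ (V L)}
    (hρ : IsGTModuleStructure L ρ) (R : tableauSet L) :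
    generatedSubmodule ρ (basisVec R) = W R := by
  refine le_antisymm (sInf_le ⟨basisVec_mem_W (mem_N_iff.2 subset_rfl),
    (stable_iff_containsGTOperators hρ _).2 (containsGTOperators_W R)⟩) (le_sInf ?_)
  rintro P ⟨hRP, hP⟩
  refine Submodule.span_le.2 ?_
  rintro _ ⟨Q, hQ, rfl⟩
  exact basisVec_mem_of_omegaPlus_subset hL ((stable_iff_containsGTOperators hρ P).1 hP) hRP hQ

theorem linearIndependent_basisVec (S : Set (tableauSet L)) :
    LinearIndependent ℂ fun Q : S => (basisVec Q.1 : V L) :=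
  (tableauBasis L).linearIndependent.comp _ Subtype.val_injective

/-- The basis `𝓝(T(R))` of `W(T(R))`. -/
noncomputable def basisW (R : tableauSet L) : Module.Basis (N R) ℂ (W R) :=
  (Module.Basis.span (linearIndependent_basisVec (N R))).map
    (LinearEquiv.ofEq _ _ (by rw [W, Set.image_eq_range]))

theorem coe_basisW (R : tableauSet L) (Q : N R) : (basisW R Q : V L) = basisVec Q.1 := by
  rw [basisW, Module.Basis.map_apply, LinearEquiv.coe_ofEq_apply, Module.Basis.span_apply]

/-- The restriction of a representation of `𝔤𝔩(n)` to a stable subspace. -/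
def restrictRep {M : Type*} [AddCommGroup M] [Module ℂ M] (ρ : gl n →ₗ⁅ℂ⁆ Module.End ℂ M)
    (P : Submodule ℂ M) (hP : ∀ x, ∀ w ∈ P, ρ x w ∈ P) : gl n →ₗ⁅ℂ⁆ Module.End ℂ P where
  toFun x := (ρ x).restrict (hP x)
  map_add' x y := by ext v; simp
  map_smul' c x := by ext v; simp
  map_lie' {x y} := by
    ext v
    simp only [LieHom.map_lie, Ring.lie_def (ρ x)]
    rfl

theorem actsByGTFormulas_N {ρ : gl n →ₗ⁅ℂ⁆ Module.End ℂ (V L)} (hρ : IsGTModuleStructure L ρ)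
    (R : tableauSet L) {P : Submodule ℂ (V L)} (b : N R → P) (hb : ∀ Q, (b Q : V L) = basisVec Q.1)
    (σ : gl n →ₗ⁅ℂ⁆ Module.End ℂ P) (hσ : ∀ x v, (σ x v : V L) = ρ x v) :
    ActsByGTFormulas (N R) b σ := by
  have hext : ∀ Q, Q ∈ N R → ((extendZero b Q : P) : V L) = basisVec Q := fun Q hQ => by
    rw [extendZero, dif_pos hQ, hb]
  refine ⟨fun k h1 hk Q => ?_, fun k h1 hk Q => ?_, fun k h1 hk Q => ?_⟩ <;>
    refine Subtype.ext ?_ <;> rw [hσ, hb]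
  · refine (hρ.raise k h1 hk ⟨Q.1, trivial⟩).trans ?_
    rw [Submodule.coe_sum]
    refine Finset.sum_congr rfl fun i hi => ?_
    rw [extendZero_univ, Submodule.coe_smul]
    -- A term leaving 𝓝(T(R)) has coefficient 0, so reading its tableau as zero changes nothing.
    rcases raise_eq_zero_or_mem_N Q.2 hk hi with h | h
    · rw [h, zero_smul, zero_smul]
    · rw [hext _ h]
  · refine (hρ.lower k h1 hk ⟨Q.1, trivial⟩).trans ?_
    rw [Submodule.coe_sum]
    refine Finset.sum_congr rfl fun i hi => ?_
    rw [extendZero_univ, Submodule.coe_smul]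
    rcases lower_eq_zero_or_mem_N Q.2 hk hi with h | h
    · rw [h, zero_smul, zero_smul]
    · rw [hext _ h]
  · rw [Submodule.coe_smul, hb]
    exact hρ.diag k h1 hk ⟨Q.1, trivial⟩

end Generation

end GelfandTsetlin

open GelfandTsetlin
theorem mainTheorem2 (n : ℕ) (hn : 2 ≤ n) (L : Tableau n) (hL : IsGeneric L) :
    (∃! ρ : gl n →ₗ⁅ℂ⁆ Module.End ℂ (V L), IsGTModuleStructure L ρ) ∧
    ∀ ρ : gl n →ₗ⁅ℂ⁆ Module.End ℂ (V L), IsGTModuleStructure L ρ →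
      ∀ R : tableauSet L,
        generatedSubmodule ρ (basisVec R) = W R ∧
        ∃ (b : Module.Basis (N R) ℂ (generatedSubmodule ρ (basisVec R)))
          (σ : gl n →ₗ⁅ℂ⁆ Module.End ℂ (generatedSubmodule ρ (basisVec R))),
          (∀ Q : N R, (b Q : V L) = basisVec Q.1) ∧
          (∀ (x : gl n) (v : generatedSubmodule ρ (basisVec R)), (σ x v : V L) = ρ x v) ∧
          ActsByGTFormulas (N R) b σ := by
  refine ⟨existsUnique_isGTModuleStructure hL, fun ρ hρ R => ?_⟩
  have hW := generatedSubmodule_eq_W hL hρ R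
  refine ⟨hW, ?_⟩
  rw [hW]
  have hstable := (stable_iff_containsGTOperators hρ _).2 (containsGTOperators_W R)
  exact ⟨basisW R, restrictRep ρ (W R) hstable, coe_basisW R, fun _ _ => rfl,
    actsByGTFormulas_N hρ R _ (coe_basisW R) _ fun _ _ => rfl⟩
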